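/- Let $K$ be an imaginary quadratic field with discriminant $d_K$, and put $D_K=|d_K|$. For $n\ge 1$ let $v_K(n)$ be the number of non-zero ideals of $\mathcal{O}_K$ of norm $n$, and for real $x>0$ let $$I_K(x)=\sideset{}{'}\sum_{1\le n\le x} v_K(n),$$ where the prime means that the term with $n=x$ (if $x$ is an integer) is halved. The Dedekind zeta function $\zeta_K(s)=\sum_{n\ge1}v_K(n)n^{-s}$ $(\Re s>1)$ continues analytically to $\mathbb{C}\setminus\{1\}$; denote the continuation by $\zeta_K$ as well, and let $H=\operatorname{Res}_{s=1}\zeta_K(s)=\lim_{s\to1}(s-1)\zeta_K(s)$. Then for every real $x>0$ $$I_K(x)=\zeta_K(0)+Hx+\sum_{n=1}^{\infty}\frac{v_K(n)}{n}\,J_1\!\left(\frac{4\pi\sqrt{nx}}{\sqrt{D_K}}\right)\sqrt{nx},$$ where $J_1(z)=\sum_{k\ge0}\frac{(-1)^k}{k!\,(k+1)!}\left(\frac z2\right)^{2k+1}$ is the Bessel function of the first kind of order $1$, and the series over $n$ converges as the limit of its partial sums $\sum_{n\le N}$ as $N\to\infty$. -/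

import Mathlib

open Filter Topology NumberField

noncomputable section

/-- The Bessel function of the first kind `J_ν` of integer order `ν ≥ 0`, at a real argument,
through its everywhere convergent power series. -/
def besselJ (ν : ℕ) (x : ℝ) : ℝ :=
  ∑' k : ℕ, (-1 : ℝ) ^ k / ((k.factorial : ℝ) * ((k + ν).factorial : ℝ)) * (x / 2) ^ (2 * k + ν)

theorem besselJ_summable (ν : ℕ) (x : ℝ) :
    Summable fun k : ℕ =>
      (-1 : ℝ) ^ k / ((k.factorial : ℝ) * ((k + ν).factorial : ℝ)) * (x / 2) ^ (2 * k + ν) := by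
  refine Summable.of_norm_bounded
    (g := fun k : ℕ => ((x / 2) ^ 2) ^ k / (k.factorial : ℝ) * |x / 2| ^ ν)
    ((Real.summable_pow_div_factorial _).mul_right _) fun k => ?_
  have h1 : (0 : ℝ) < k.factorial := by exact_mod_cast k.factorial_pos
  have h2 : (1 : ℝ) ≤ (k + ν).factorial := by exact_mod_cast (k + ν).factorial_pos
  have h3 : |x / 2| ^ (2 * k + ν) = ((x / 2) ^ 2) ^ k * |x / 2| ^ ν := by
    rw [pow_add, pow_mul, sq_abs]
  rw [norm_mul, norm_div, norm_pow, norm_pow, norm_neg, norm_one, one_pow, Real.norm_eq_abs,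
    Real.norm_eq_abs, h3, abs_of_pos (mul_pos h1 (by linarith)), div_mul_eq_mul_div, one_mul,
    div_mul_eq_mul_div]
  gcongr
  nlinarith

/-- The number of non-zero integral ideals of norm `n`. -/
def idealNormCount (K : Type*) [Field K] [NumberField K] (n : ℕ) : ℕ :=
  Nat.card {I : Ideal (𝓞 K) // I ≠ ⊥ ∧ Ideal.absNorm I = n}

/-- The number of non-zero integral ideals of norm at most `x`, those of norm exactly `x` being
counted with weight one half. -/
def idealCount (K : Type*) [Field K] [NumberField K] (x : ℝ) : ℝ :=
  ∑ n ∈ Finset.Icc 1 ⌊x⌋₊, (if (n : ℝ) = x then 1 / 2 else 1) * (idealNormCount K n : ℝ)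

/-- `Z` is the analytic continuation to `ℂ ∖ {1}` of the Dedekind zeta function of `K`; by the
identity theorem its values off `1` are determined by `K`. (Mathlib's `dedekindZeta` is the
Dirichlet series, hence meaningful only in its half-plane of convergence.) -/
def IsDedekindZetaContinuation (K : Type*) [Field K] [NumberField K] (Z : ℂ → ℂ) : Prop :=
  DifferentiableOn ℂ Z {1}ᶜ ∧ ∀ s : ℂ, 1 < s.re → Z s = dedekindZeta K s

end

noncomputable section

/-! Put r(n) = v_K(n) for n ≥ 1, r(0) = h/w (class number over number of units) and a = 4π²/D_K.
Everything follows from one relation: θ(s) = ∑ r(n) e^(-ns) satisfies θ(s) = (√a/s) θ(a/s), recorded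
as `SelfDualTheta`. It holds class by class. Up to units, the nonzero elements of an ideal J in the
class c⁻¹ are the ideals of c, and their norms divided by N(J) are the values of a positive definite
binary form of discriminant -D_K, to which Poisson summation applies in each variable
(`tsum_exp_neg_binForm`, `selfDualTheta_idealThetaCoeff`).

The Mellin transform of θ continues ζ_K, with residue H = √a r(0) and value ζ_K(0) = -r(0)
(`exists_continuation`). The claim thus becomes Hardy's identity `tendsto_sum_range_besselE`: the
sum over n ≥ 0 of r(n) √a x E_1(axn) equals r(0) + I_K(x), its term n = 0 being Hx.

The decay of E_1 is too weak for absolute convergence, so the argument starts from the Riesz mean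
L(t) = ∑ r(n) (t-n)₊, whose Laplace transform is θ(s)/s². Since t² E_2(bt) has transform
e^(-b/s)/s³, the functional equation and injectivity of the Laplace transform give the absolutely
convergent expansion L(t) = √a ∑ r(n) t² E_2(ant) (`riesz_mean_eq`). Two summations by parts turn
the N-th partial sum of Hardy's series into boundary terms plus the integral of L φ'' over [0, N],
where φ(t) = √a x E_1(axt). Inserting the expansion of L produces ∑ r(n) `discontIntegral` (an) (ax)
N. For n ≥ 1 these truncated Weber-Schafheitlin integrals tend to 1, 1/2 or 0 as n < x, n = x or n >
x, which are the weights in I_K(x); the bound `exists_discontIntegral_bound`, uniform in N, allows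
the limit to be taken termwise. The n = 0 integral cancels the main parts of the boundary terms, and
the rest vanishes by `exists_sum_error_bound` and `exists_riesz_error_bound`. -/

/-! ### Bessel functions as entire functions of y = z²/4, and their decay -/

/-- The entire function `E_ν` with `J_ν (2 √y) = y ^ (ν / 2) * E_ν y`. -/
def besselE (ν : ℕ) (y : ℝ) : ℝ :=
  ∑' k : ℕ, (-1 : ℝ) ^ k / ((k.factorial : ℝ) * ((k + ν).factorial : ℝ)) * y ^ k

theorem summable_besselE_of_abs (ν : ℕ) (y : ℝ) :
    Summable fun k : ℕ => |(-1 : ℝ) ^ k / ((k.factorial : ℝ) * ((k + ν).factorial : ℝ)) * y ^ k| := by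
  refine Summable.of_nonneg_of_le (fun _ => abs_nonneg _) (fun k => ?_)
    (Real.summable_pow_div_factorial |y|)
  have h1 : (0 : ℝ) < k.factorial := by exact_mod_cast k.factorial_pos
  have h2 : (1 : ℝ) ≤ (k + ν).factorial := by exact_mod_cast (k + ν).factorial_pos
  rw [abs_mul, abs_div, abs_pow, abs_pow, abs_neg, abs_one, one_pow,
    abs_of_pos (mul_pos h1 (by linarith)), div_mul_eq_mul_div, one_mul]
  gcongr
  nlinarith

theorem summable_besselE (ν : ℕ) (y : ℝ) :
    Summable fun k : ℕ => (-1 : ℝ) ^ k / ((k.factorial : ℝ) * ((k + ν).factorial : ℝ)) * y ^ k :=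
  (summable_besselE_of_abs ν y).of_abs

theorem besselE_zero_right (ν : ℕ) : besselE ν 0 = 1 / (ν.factorial : ℝ) := by
  rw [besselE, tsum_eq_single 0]
  · simp
  · intro k hk; simp [hk]

theorem besselJ_one_two_mul_sqrt {y : ℝ} (hy : 0 ≤ y) :
    besselJ 1 (2 * √y) = √y * besselE 1 y := by
  rw [besselJ, besselE, ← tsum_mul_left]
  refine tsum_congr fun k => ?_
  rw [mul_div_cancel_left₀ _ (two_ne_zero), pow_succ, pow_mul, Real.sq_sqrt hy]
  ring

/-- Termwise differentiation shifts k by one and so raises the order by one, with no extra factor.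
This is the advantage of E_ν over J_ν in the calculus below. -/
theorem hasDerivAt_besselE (ν : ℕ) (y : ℝ) :
    HasDerivAt (besselE ν) (-besselE (ν + 1) y) y := by
  set R : ℝ := |y| + 1 with hR
  have hRpos : 0 < R := by positivity
  set g : ℕ → ℝ → ℝ := fun k t =>
    (-1 : ℝ) ^ k / ((k.factorial : ℝ) * ((k + ν).factorial : ℝ)) * t ^ k with hg
  set g' : ℕ → ℝ → ℝ := fun k t =>
    (-1 : ℝ) ^ k / ((k.factorial : ℝ) * ((k + ν).factorial : ℝ)) * (k * t ^ (k - 1)) with hg'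
  have hu : Summable fun k : ℕ => (k : ℝ) * R ^ (k - 1) / k.factorial := by
    rw [← summable_nat_add_iff 1]
    refine (Real.summable_pow_div_factorial R).congr fun k => ?_
    rw [Nat.factorial_succ]
    have h1 : (0 : ℝ) < k.factorial := by exact_mod_cast k.factorial_pos
    push_cast
    field_simp
  have key : HasDerivAt (fun z => ∑' k, g k z) (∑' k, g' k y) y := by
    refine hasDerivAt_tsum_of_isPreconnected (t := Metric.ball 0 R) (y₀ := 0) hu Metric.isOpen_ball
      (convex_ball _ _).isPreconnected (fun k t _ => ?_) (fun k t ht => ?_)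
      (Metric.mem_ball_self hRpos) (summable_besselE ν 0) ?_
    · simpa using (hasDerivAt_pow k t).const_mul _
    · have h1 : (0 : ℝ) < k.factorial := by exact_mod_cast k.factorial_pos
      have h2 : (1 : ℝ) ≤ (k + ν).factorial := by exact_mod_cast (k + ν).factorial_pos
      have ht' : |t| ≤ R := by simpa using (mem_ball_zero_iff.1 ht).le
      simp only [hg', Real.norm_eq_abs]
      rw [abs_mul, abs_div, abs_pow, abs_neg, abs_one, one_pow,
        abs_of_pos (mul_pos h1 (by linarith)), div_mul_eq_mul_div, one_mul, abs_mul, abs_pow,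
        Nat.abs_cast]
      gcongr
      nlinarith
    · simp [hR]
  have hsum : ∑' k, g' k y = -besselE (ν + 1) y := by
    have hs : Summable fun k => g' k y := by
      rw [← summable_nat_add_iff 1]
      refine (summable_besselE (ν + 1) y).neg.congr fun k => ?_
      have h1 : (0 : ℝ) < k.factorial := by exact_mod_cast k.factorial_pos
      have h2 : (0 : ℝ) < (k + (ν + 1)).factorial := by exact_mod_cast (k + (ν + 1)).factorial_pos
      simp only [hg']
      rw [show k + 1 + ν = k + (ν + 1) by ring, Nat.factorial_succ]
      push_cast
      field_simp
      ring
    rw [hs.tsum_eq_zero_add, besselE, ← tsum_neg]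
    simp only [hg', Nat.cast_zero, zero_mul, mul_zero, zero_add]
    refine tsum_congr fun k => ?_
    have h1 : (0 : ℝ) < k.factorial := by exact_mod_cast k.factorial_pos
    have h2 : (0 : ℝ) < (k + (ν + 1)).factorial := by exact_mod_cast (k + (ν + 1)).factorial_pos
    rw [show k + 1 + ν = k + (ν + 1) by ring, Nat.factorial_succ]
    push_cast
    field_simp
    ring
  rw [← hsum]
  exact key

theorem continuous_besselE (ν : ℕ) : Continuous (besselE ν) :=
  continuous_iff_continuousAt.2 fun y => (hasDerivAt_besselE ν y).continuousAt

/-- This is the three-term Bessel recurrence: the constant term on the right cancels, and its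
coefficient of index k + 1 is the coefficient of index k of E_(ν+2). -/
theorem mul_besselE_add_two (ν : ℕ) (y : ℝ) :
    y * besselE (ν + 2) y = (ν + 1) * besselE (ν + 1) y - besselE ν y := by
  have hs := ((summable_besselE (ν + 1) y).mul_left ((ν : ℝ) + 1)).sub (summable_besselE ν y)
  rw [besselE, besselE, besselE, ← tsum_mul_left, ← tsum_mul_left,
    ← ((summable_besselE (ν + 1) y).mul_left ((ν : ℝ) + 1)).tsum_sub (summable_besselE ν y),
    hs.tsum_eq_zero_add]
  have h0 : (0 : ℝ) < ν.factorial := by exact_mod_cast ν.factorial_pos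
  have hz : ((ν : ℝ) + 1) * ((-1 : ℝ) ^ 0 / (((0 : ℕ).factorial : ℝ) *
      ((0 + (ν + 1)).factorial : ℝ)) * y ^ 0) -
      (-1 : ℝ) ^ 0 / (((0 : ℕ).factorial : ℝ) * ((0 + ν).factorial : ℝ)) * y ^ 0 = 0 := by
    rw [zero_add, zero_add, Nat.factorial_succ]
    push_cast
    field_simp
    simp
  rw [hz, zero_add]
  refine tsum_congr fun k => ?_
  have h1 : (0 : ℝ) < k.factorial := by exact_mod_cast k.factorial_pos
  have h2 : (0 : ℝ) < (k + ν + 1).factorial := by exact_mod_cast (k + ν + 1).factorial_pos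
  rw [show k + (ν + 2) = (k + ν + 1) + 1 by ring, show k + 1 + (ν + 1) = (k + ν + 1) + 1 by ring,
    show k + 1 + ν = k + ν + 1 by ring, Nat.factorial_succ (k + ν + 1), Nat.factorial_succ k]
  push_cast
  field_simp
  ring

theorem hasDerivAt_besselE_mul (ν : ℕ) (b t : ℝ) :
    HasDerivAt (fun t => besselE ν (b * t)) (-(b * besselE (ν + 1) (b * t))) t := by
  have := (hasDerivAt_besselE ν (b * t)).comp t ((hasDerivAt_id t).const_mul b)
  refine this.congr_deriv ?_
  simp; ring

/-- The energy bound for the Bessel equation. -/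
theorem exists_besselE_energy_bound :
    ∃ C : ℝ, 0 < C ∧ ∀ y : ℝ, 1 ≤ y →
      √y * (besselE 0 y ^ 2 + y * besselE 1 y ^ 2) ≤ C := by
  -- In terms of J this is z(J_0² + J_1²)/2 with a lower-order correction. The term E_0 E_1 / 2 is
  -- chosen to cancel (E_0² - y E_1²)/(2√y) in the derivative, leaving only E_0 E_1/(4√y).
  set A : ℝ → ℝ := fun y =>
    √y * (besselE 0 y ^ 2 + y * besselE 1 y ^ 2 - besselE 0 y * besselE 1 y / 2) with hA
  -- Integrating factor: A' ≤ A y^(-3/2) for y > 1, and 2/√y has derivative -y^(-3/2). Hence G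
  -- decreases while exp(2/√y) stays between 1 and e².
  set G : ℝ → ℝ := fun y => A y * Real.exp (2 / √y) with hG
  have hE0 (y : ℝ) := hasDerivAt_besselE 0 y
  have hE1 (y : ℝ) : HasDerivAt (besselE 1) (-besselE 2 y) y := hasDerivAt_besselE 1 y
  have hrec (y : ℝ) : y * besselE 2 y = besselE 1 y - besselE 0 y := by
    simpa using mul_besselE_add_two 0 y
  have hsq (y : ℝ) (hy : 0 < y) : HasDerivAt (fun y : ℝ => √y) (1 / (2 * √y)) y :=
    Real.hasDerivAt_sqrt hy.ne'
  have hAd (y : ℝ) (hy : 0 < y) :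
      HasDerivAt A (besselE 0 y * besselE 1 y / (4 * √y)) y := by
    refine ((hsq y hy).mul ((((hE0 y).pow 2).add ((hasDerivAt_id y).mul ((hE1 y).pow 2))).sub
      (((hE0 y).mul (hE1 y)).div_const 2))).congr_deriv ?_
    have hs : √y ≠ 0 := (Real.sqrt_pos.2 hy).ne'
    have hss : √y ^ 2 = y := Real.sq_sqrt hy.le
    simp only [Pi.pow_apply, Pi.mul_apply, Pi.add_apply, Pi.sub_apply, id]
    field_simp
    rw [hss]
    push_cast
    linear_combination (-32 * besselE 1 y * y + 8 * besselE 0 y) * hrec y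
  have hGd (y : ℝ) (hy : 0 < y) :
      HasDerivAt G (besselE 0 y * besselE 1 y / (4 * √y) * Real.exp (2 / √y) +
        A y * (Real.exp (2 / √y) * (-(1 / (y * √y))))) y := by
    refine (hAd y hy).mul ((Real.hasDerivAt_exp _).comp y ?_)
    refine ((hasDerivAt_const y (2 : ℝ)).div (hsq y hy) (Real.sqrt_pos.2 hy).ne').congr_deriv ?_
    have hs : √y ≠ 0 := (Real.sqrt_pos.2 hy).ne'
    have hss : √y ^ 2 = y := Real.sq_sqrt hy.le
    rw [hss]
    field_simp
    ring
  have hlow (y : ℝ) (hy : 1 ≤ y) :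
      √y * (besselE 0 y ^ 2 + y * besselE 1 y ^ 2) ≤ 2 * A y := by
    have hs : 0 ≤ √y := Real.sqrt_nonneg _
    have : 0 ≤ √y * ((besselE 0 y - besselE 1 y / 2) ^ 2 + (y - 1 / 4) * besselE 1 y ^ 2) := by
      have : 0 ≤ y - 1 / 4 := by linarith
      positivity
    simp only [hA]
    linarith
  have hanti : AntitoneOn G (Set.Ici 1) := by
    refine antitoneOn_of_deriv_nonpos (convex_Ici 1) ?_ ?_ ?_
    · exact fun y hy => (hGd y (by have : 1 ≤ y := hy; linarith)).continuousAt.continuousWithinAt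
    · intro y hy
      rw [interior_Ici] at hy
      exact (hGd y (by have : 1 < y := hy; linarith)).differentiableAt.differentiableWithinAt
    · intro y hy
      rw [interior_Ici] at hy
      have hy1 : 1 < y := hy
      have hy0 : 0 < y := by linarith
      rw [(hGd y hy0).deriv]
      have hs : 0 < √y := Real.sqrt_pos.2 hy0
      have hss : √y ^ 2 = y := Real.sq_sqrt hy0.le
      have hl := hlow y hy1.le
      have h3 : besselE 0 y * besselE 1 y / (4 * √y) - A y / (y * √y) ≤ 0 := by
        rw [div_sub_div _ _ (by positivity) (by positivity)]
        apply div_nonpos_of_nonpos_of_nonneg _ (by positivity)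
        have h4 : √y * (besselE 0 y * besselE 1 y) ≤
            (besselE 0 y ^ 2 + y * besselE 1 y ^ 2) := by
          nlinarith [sq_nonneg (besselE 0 y - √y * besselE 1 y),
            sq_nonneg (besselE 0 y + √y * besselE 1 y)]
        have h5 : y * (besselE 0 y * besselE 1 y) ≤ 4 * A y := by
          have : √y * (√y * (besselE 0 y * besselE 1 y)) ≤ 2 * A y :=
            (mul_le_mul_of_nonneg_left h4 hs.le).trans hl
          rw [← mul_assoc, ← sq, hss] at this
          have hA0 : 0 ≤ A y := by
            have : 0 ≤ √y * (besselE 0 y ^ 2 + y * besselE 1 y ^ 2) := by positivity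
            linarith
          linarith
        nlinarith [mul_le_mul_of_nonneg_left h5 hs.le]
      have : besselE 0 y * besselE 1 y / (4 * √y) * Real.exp (2 / √y) +
        A y * (Real.exp (2 / √y) * (-(1 / (y * √y)))) =
        (besselE 0 y * besselE 1 y / (4 * √y) - A y / (y * √y)) * Real.exp (2 / √y) := by ring
      rw [this]
      exact mul_nonpos_of_nonpos_of_nonneg h3 (Real.exp_pos _).le
  have hA0 (y : ℝ) (hy : 1 ≤ y) : 0 ≤ A y := by
    have : 0 ≤ √y * (besselE 0 y ^ 2 + y * besselE 1 y ^ 2) := by positivity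
    linarith [hlow y hy]
  refine ⟨2 * G 1 + 1, ?_, fun y hy => (hlow y hy).trans ?_⟩
  · have : 0 ≤ G 1 := mul_nonneg (hA0 1 le_rfl) (Real.exp_pos _).le
    linarith
  · have h1 : G y ≤ G 1 := hanti Set.self_mem_Ici hy hy
    have h2 : A y ≤ G y := le_mul_of_one_le_right (hA0 y hy) (Real.one_le_exp (by positivity))
    linarith

/-- The exponent reflects J_ν(z) = O(z^(-1/2)). The energy bound supplies orders 0 and 1, and the
recurrence divided by y supplies the others, E_ν / y being the dominant term. -/
theorem exists_besselE_bound_of_one_le (ν : ℕ) :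
    ∃ C : ℝ, 0 < C ∧ ∀ y : ℝ, 1 ≤ y → |besselE ν y| ≤ C * y ^ (-(ν / 2 + 1 / 4) : ℝ) := by
  obtain ⟨C, hC, hb⟩ := exists_besselE_energy_bound
  induction ν using Nat.twoStepInduction with
  | zero =>
    refine ⟨√C, Real.sqrt_pos.2 hC, fun y hy => ?_⟩
    have hy0 : 0 < y := by linarith
    have hq : √y * (y ^ (-((0 : ℕ) / 2 + 1 / 4) : ℝ)) ^ 2 = 1 := by
      rw [← Real.rpow_natCast, ← Real.rpow_mul hy0.le, Real.sqrt_eq_rpow, ← Real.rpow_add hy0]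
      norm_num
    refine abs_le_of_sq_le_sq ?_ (by positivity)
    refine le_of_mul_le_mul_left ?_ (Real.sqrt_pos.2 hy0)
    rw [mul_pow, Real.sq_sqrt hC.le, mul_left_comm, hq, mul_one]
    refine le_trans ?_ (hb y hy)
    gcongr
    have : 0 ≤ y * besselE 1 y ^ 2 := by positivity
    linarith
  | one =>
    refine ⟨√C, Real.sqrt_pos.2 hC, fun y hy => ?_⟩
    have hy0 : 0 < y := by linarith
    have hq : √y * y * (y ^ (-((1 : ℕ) / 2 + 1 / 4) : ℝ)) ^ 2 = 1 := by
      rw [← Real.rpow_natCast, ← Real.rpow_mul hy0.le, Real.sqrt_eq_rpow,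
        ← Real.rpow_add_one hy0.ne', ← Real.rpow_add hy0]
      norm_num
    refine abs_le_of_sq_le_sq ?_ (by positivity)
    refine le_of_mul_le_mul_left ?_ (mul_pos (Real.sqrt_pos.2 hy0) hy0)
    rw [mul_pow, Real.sq_sqrt hC.le, mul_left_comm, hq, mul_one, mul_assoc]
    refine le_trans ?_ (hb y hy)
    gcongr
    have : 0 ≤ besselE 0 y ^ 2 := by positivity
    linarith
  | more ν h0 h1 =>
    obtain ⟨C0, hC0, h0⟩ := h0
    obtain ⟨C1, hC1, h1⟩ := h1
    refine ⟨(ν + 1) * C1 + C0, by positivity, fun y hy => ?_⟩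
    have hy0 : 0 < y := by linarith
    have hr := mul_besselE_add_two ν y
    have : |besselE (ν + 2) y| = |(ν + 1) * besselE (ν + 1) y - besselE ν y| / y := by
      rw [← hr, abs_mul, abs_of_pos hy0]; field_simp
    rw [this, div_le_iff₀ hy0]
    refine (abs_sub _ _).trans ?_
    rw [abs_mul, abs_of_nonneg (by positivity : (0 : ℝ) ≤ ν + 1)]
    have e1 : y ^ (-(((ν + 2 : ℕ) : ℝ) / 2 + 1 / 4)) * y = y ^ (-((ν : ℝ) / 2 + 1 / 4)) := by
      rw [← Real.rpow_add_one hy0.ne']; congr 1; push_cast; ring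
    have e2 : y ^ (-(((ν + 1 : ℕ) : ℝ) / 2 + 1 / 4)) ≤ y ^ (-((ν : ℝ) / 2 + 1 / 4)) := by
      apply Real.rpow_le_rpow_of_exponent_le hy; push_cast; linarith
    rw [mul_assoc, e1, add_mul (((ν : ℝ) + 1) * C1)]
    refine add_le_add ?_ (h0 y hy)
    rw [mul_assoc]
    refine mul_le_mul_of_nonneg_left ((h1 y hy).trans ?_) (by positivity)
    gcongr

/-! ### Injectivity of the Laplace transform -/

theorem exists_one_add_pow_le_exp (k : ℕ) {s : ℝ} (hs : 0 < s) :
    ∃ K : ℝ, 0 < K ∧ ∀ t : ℝ, 0 ≤ t → (1 + t) ^ k ≤ K * Real.exp (s * t) := by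
  refine ⟨k.factorial / s ^ k * Real.exp s, by positivity, fun t ht => ?_⟩
  have := Real.pow_div_factorial_le_exp (s * (1 + t)) (by positivity) k
  rw [div_le_iff₀ (by positivity), mul_pow, mul_add, mul_one, Real.exp_add] at this
  rw [div_mul_eq_mul_div, div_mul_eq_mul_div, le_div_iff₀ (by positivity)]
  linarith

open MeasureTheory Set in
theorem integrableOn_exp_mul_of_le_exp {F : ℝ → ℝ} (hF : ContinuousOn F (Ici 0)) {K b : ℝ}
    (hb : ∀ t, 0 ≤ t → |F t| ≤ K * Real.exp (b * t)) {s : ℝ} (hs : b < s) :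
    IntegrableOn (fun t => Real.exp (-s * t) * F t) (Ioi 0) := by
  refine Integrable.mono' ((integrableOn_exp_mul_Ioi (show b - s < 0 by linarith) 0).const_mul K)
    ?_ ?_
  · refine ContinuousOn.aestronglyMeasurable ?_ measurableSet_Ioi
    exact (by fun_prop : Continuous fun t : ℝ => Real.exp (-s * t)).continuousOn.mul
      (hF.mono Ioi_subset_Ici_self)
  · refine (ae_restrict_mem measurableSet_Ioi).mono fun t ht => ?_
    have ht0 : 0 < t := ht
    rw [Real.norm_eq_abs, abs_mul, Real.abs_exp]
    calc Real.exp (-s * t) * |F t| ≤ Real.exp (-s * t) * (K * Real.exp (b * t)) := by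
          gcongr; exact hb t ht0.le
      _ = K * (Real.exp (-s * t) * Real.exp (b * t)) := by ring
      _ = K * Real.exp ((b - s) * t) := by rw [← Real.exp_add]; ring_nf

open MeasureTheory Set in
/-- Injectivity of the Laplace transform on continuous functions of polynomial growth. -/
theorem eq_zero_of_laplace_eq_zero {F : ℝ → ℝ} (hF : ContinuousOn F (Ici 0)) {C : ℝ} {k : ℕ}
    (hb : ∀ t, 0 ≤ t → |F t| ≤ C * (1 + t) ^ k)
    (h : ∀ s : ℝ, 0 < s → ∫ t in Ioi 0, Real.exp (-s * t) * F t = 0) {t : ℝ} (ht : 0 < t) :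
    F t = 0 := by
  obtain ⟨K₀, hK₀, hK₀b⟩ := exists_one_add_pow_le_exp k (show (0 : ℝ) < 1 / 2 by norm_num)
  have hC : 0 ≤ C := by simpa using (abs_nonneg _).trans (hb 0 le_rfl)
  set K := C * K₀ with hK
  have hKb : ∀ t, 0 ≤ t → |F t| ≤ K * Real.exp (1 / 2 * t) := fun t ht =>
    (hb t ht).trans (by rw [hK, mul_assoc]; exact mul_le_mul_of_nonneg_left (hK₀b t ht) hC)
  have hint (s : ℝ) (hs : 1 / 2 < s) := integrableOn_exp_mul_of_le_exp hF hKb hs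
  set G : ℝ → ℝ := fun t => F (max t 0) with hG
  have hGc : Continuous G := by
    rw [← continuousOn_univ]
    exact hF.comp (by fun_prop) (fun t _ => le_max_right t 0)
  -- Substitution u = e^(-t). The extra factor u absorbs the growth of F, so that g extends
  -- continuously by 0 to u = 0 and Weierstrass approximation applies on [0, 1].
  set g : ℝ → ℝ := fun u => u * G (-Real.log u) with hg
  have hgF (t : ℝ) (ht : 0 ≤ t) : g (Real.exp (-t)) = Real.exp (-t) * F t := by
    simp [hg, hG, ht]
  have hgb (u : ℝ) (hu : u ∈ Icc (0 : ℝ) 1) : |g u| ≤ K * √u := by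
    rcases hu.1.eq_or_lt with rfl | hu0
    · simp [hg]
    · have h1 := hgF (-Real.log u) (by linarith [Real.log_nonpos hu.1 hu.2])
      rw [neg_neg, Real.exp_log hu0] at h1
      rw [h1, abs_mul, abs_of_pos hu0]
      have h2 := hKb (-Real.log u) (by linarith [Real.log_nonpos hu.1 hu.2])
      have h3 : u * Real.exp (1 / 2 * -Real.log u) = √u := by
        rw [Real.sqrt_eq_rpow, Real.rpow_def_of_pos hu0]
        nth_rewrite 1 [← Real.exp_log hu0]
        rw [← Real.exp_add]; ring_nf
      calc u * |F (-Real.log u)| ≤ u * (K * Real.exp (1 / 2 * -Real.log u)) := by gcongr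
        _ = K * √u := by rw [← h3]; ring
  have hgc : ContinuousOn g (Icc 0 1) := by
    intro u hu
    rcases hu.1.eq_or_lt with rfl | hu0
    · have h0 : g 0 = 0 := by simp [hg]
      rw [ContinuousWithinAt, h0]
      refine squeeze_zero_norm' (a := fun u => K * √u) ?_ ?_
      · filter_upwards [self_mem_nhdsWithin] with u hu using hgb u hu
      · have : Tendsto (fun u => K * √u) (𝓝 0) (𝓝 (K * √0)) :=
          (by fun_prop : Continuous fun u => K * √u).tendsto 0
        rw [Real.sqrt_zero, mul_zero] at this
        exact this.mono_left nhdsWithin_le_nhds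
    · exact (continuousAt_id.mul (hGc.continuousAt.comp
        (Real.continuousAt_log hu0.ne').neg)).continuousWithinAt
  set I := ∫ t in Ioi 0, Real.exp (-3 * t) * F t ^ 2 with hI
  have hIint : IntegrableOn (fun t => Real.exp (-3 * t) * F t ^ 2) (Ioi 0) := by
    refine integrableOn_exp_mul_of_le_exp (K := K ^ 2) (b := 1) (hF.pow 2) (fun t ht => ?_)
      (by norm_num)
    rw [Pi.pow_apply, abs_pow]
    refine (pow_le_pow_left₀ (abs_nonneg _) (hKb t ht) 2).trans_eq ?_
    rw [mul_pow, ← Real.exp_nat_mul]; ring_nf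
  set M := ∫ t in Ioi 0, Real.exp (-2 * t) * |F t| with hM
  have hMint : IntegrableOn (fun t => Real.exp (-2 * t) * |F t|) (Ioi 0) :=
    integrableOn_exp_mul_of_le_exp (K := K) (b := 1 / 2) hF.abs
      (fun t ht => by rw [abs_abs]; exact hKb t ht) (by norm_num)
  have hM0 : 0 ≤ M := setIntegral_nonneg measurableSet_Ioi fun t _ => by positivity
  have hpoly (p : Polynomial ℝ) :
      (fun t => Real.exp (-2 * t) * F t * p.eval (Real.exp (-t))) =
        fun t => ∑ i ∈ Finset.range (p.natDegree + 1),
          p.coeff i * (Real.exp (-((i : ℝ) + 2) * t) * F t) := by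
    funext t
    rw [Polynomial.eval_eq_sum_range, Finset.mul_sum]
    refine Finset.sum_congr rfl fun i _ => ?_
    rw [show -((i : ℝ) + 2) * t = -2 * t + i * (-t) by ring, Real.exp_add, Real.exp_nat_mul]
    ring
  have hpint (p : Polynomial ℝ) :
      IntegrableOn (fun t => Real.exp (-2 * t) * F t * p.eval (Real.exp (-t))) (Ioi 0) := by
    rw [hpoly]
    exact integrable_finsetSum _ fun i _ =>
      (hint ((i : ℝ) + 2) (by have : (0 : ℝ) ≤ i := i.cast_nonneg; linarith)).const_mul _
  have hpzero (p : Polynomial ℝ) :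
      ∫ t in Ioi 0, Real.exp (-2 * t) * F t * p.eval (Real.exp (-t)) = 0 := by
    rw [hpoly, integral_finsetSum]
    swap
    · exact fun i _ => (hint ((i : ℝ) + 2)
        (by have : (0 : ℝ) ≤ i := i.cast_nonneg; linarith)).const_mul _
    refine Finset.sum_eq_zero fun i _ => ?_
    rw [integral_const_mul, h _ (by positivity), mul_zero]
  -- Since e^(-2t) F is orthogonal to every polynomial in e^(-t), subtracting the approximant p of
  -- e^(-t) F costs nothing and leaves a factor of size at most ε.
  have hle (ε : ℝ) (hε : 0 < ε) : I ≤ ε * M := by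
    obtain ⟨p, hp⟩ := exists_polynomial_near_of_continuousOn 0 1 g hgc ε hε
    rw [← sub_zero I, ← hpzero p, hI, ← integral_sub hIint (hpint p), hM, ← integral_const_mul]
    refine setIntegral_mono_on (hIint.sub (hpint p)) (hMint.const_mul ε) measurableSet_Ioi
      fun t ht => ?_
    have ht0 : 0 < t := ht
    have h1 := hp (Real.exp (-t)) ⟨(Real.exp_pos _).le, Real.exp_le_one_iff.2 (by linarith)⟩
    rw [hgF t ht0.le, abs_sub_comm] at h1
    have h2 : Real.exp (-3 * t) * F t ^ 2 - Real.exp (-2 * t) * F t * p.eval (Real.exp (-t)) =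
        Real.exp (-2 * t) * (F t * (Real.exp (-t) * F t - p.eval (Real.exp (-t)))) := by
      rw [show -3 * t = -2 * t + -t by ring, Real.exp_add]; ring
    rw [h2]
    calc _ ≤ Real.exp (-2 * t) * |F t * (Real.exp (-t) * F t - p.eval (Real.exp (-t)))| := by
          gcongr; exact le_abs_self _
      _ ≤ Real.exp (-2 * t) * (|F t| * ε) := by rw [abs_mul]; gcongr
      _ = _ := by ring
  have hI0 : I = 0 := by
    refine le_antisymm ?_ (setIntegral_nonneg measurableSet_Ioi fun t _ => by positivity)
    refine le_of_forall_pos_le_add fun ε hε => ?_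
    have := hle (ε / (M + 1)) (by positivity)
    refine this.trans ?_
    rw [zero_add, div_mul_eq_mul_div, div_le_iff₀ (by positivity)]
    nlinarith
  have hae := (setIntegral_eq_zero_iff_of_nonneg_ae
    (Eventually.of_forall fun t => by positivity) hIint).1 hI0
  have heq := Measure.eqOn_open_of_ae_eq hae isOpen_Ioi
    ((by fun_prop : Continuous fun t : ℝ => Real.exp (-3 * t)).continuousOn.mul
      ((hF.mono Ioi_subset_Ici_self).pow 2)) continuousOn_const
  have := heq ht
  simpa [(Real.exp_pos _).ne'] using this

/-! ### Uniform bounds for E_ν on the half-line -/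

theorem exists_besselE_bound (ν : ℕ) :
    ∃ C : ℝ, 0 < C ∧ ∀ y : ℝ, 0 ≤ y → |besselE ν y| ≤ C * (1 + y) ^ (-(ν / 2 + 1 / 4) : ℝ) := by
  obtain ⟨C, hC, hCb⟩ := exists_besselE_bound_of_one_le ν
  obtain ⟨B, hB⟩ := (isCompact_Icc (a := (0 : ℝ)) (b := 1)).exists_bound_of_continuousOn
    (continuous_besselE ν).continuousOn
  set p : ℝ := ν / 2 + 1 / 4 with hp
  have hp0 : 0 < p := by positivity
  refine ⟨(C + |B|) * 2 ^ p, by positivity, fun y hy => ?_⟩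
  have h2 : (2 : ℝ) ^ p * (1 + y) ^ (-p) = ((1 + y) / 2) ^ (-p) := by
    rw [Real.div_rpow (by positivity) (by norm_num), Real.rpow_neg (by norm_num : (0 : ℝ) ≤ 2),
      div_inv_eq_mul, mul_comm]
  rw [mul_assoc, h2]
  rcases le_total y 1 with h | h
  · have h3 : 1 ≤ ((1 + y) / 2) ^ (-p) :=
      Real.one_le_rpow_of_pos_of_le_one_of_nonpos (by positivity) (by linarith) (by linarith)
    have h4 := hB y ⟨hy, h⟩
    rw [Real.norm_eq_abs] at h4
    nlinarith [le_abs_self B, abs_nonneg B]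
  · refine (hCb y h).trans ?_
    have h3 : y ^ (-p) ≤ ((1 + y) / 2) ^ (-p) :=
      Real.rpow_le_rpow_of_nonpos (by positivity) (by linarith) (by linarith)
    have h4 : 0 ≤ ((1 + y) / 2) ^ (-p) := by positivity
    calc C * y ^ (-p) ≤ C * ((1 + y) / 2) ^ (-p) := by gcongr
      _ ≤ (C + |B|) * ((1 + y) / 2) ^ (-p) := by gcongr; linarith [abs_nonneg B]

/-- Split c^ν as c^p c^(ν-p): the first factor is handled by c(1 + t) ≤ (1 + c)(1 + ct), the second
by c ≤ 1 + c. -/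
theorem pow_mul_rpow_neg_le {ν : ℕ} {p c t : ℝ} (hp : 0 ≤ p) (hpν : p ≤ ν) (hc : 0 ≤ c)
    (ht : 0 ≤ t) : c ^ ν * (1 + c * t) ^ (-p) ≤ (1 + c) ^ ν * (1 + t) ^ (-p) := by
  rcases hc.eq_or_lt with rfl | hc0
  · rcases Nat.eq_zero_or_pos ν with rfl | hν
    · have : p = 0 := le_antisymm (by simpa using hpν) hp
      simp [this]
    · rw [zero_pow hν.ne']; simp; positivity
  · have e (x : ℝ) (hx : 0 < x) : x ^ ν = x ^ p * x ^ ((ν : ℝ) - p) := by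
      rw [← Real.rpow_add hx, ← Real.rpow_natCast]; ring_nf
    have hq : 0 ≤ (ν : ℝ) - p := by linarith
    rw [e c hc0, e (1 + c) (by positivity), Real.rpow_neg (by positivity),
      Real.rpow_neg (by positivity), ← div_eq_mul_inv, ← div_eq_mul_inv,
      div_le_div_iff₀ (by positivity) (by positivity)]
    have h1 : c ^ p * (1 + t) ^ p ≤ (1 + c) ^ p * (1 + c * t) ^ p := by
      rw [← Real.mul_rpow (by positivity) (by positivity),
        ← Real.mul_rpow (by positivity) (by positivity)]
      apply Real.rpow_le_rpow (by positivity) _ hp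
      nlinarith [mul_nonneg (mul_nonneg hc hc) ht]
    have h2 : c ^ ((ν : ℝ) - p) ≤ (1 + c) ^ ((ν : ℝ) - p) :=
      Real.rpow_le_rpow hc (by linarith) hq
    calc c ^ p * c ^ ((ν : ℝ) - p) * (1 + t) ^ p
        = (c ^ p * (1 + t) ^ p) * c ^ ((ν : ℝ) - p) := by ring
      _ ≤ ((1 + c) ^ p * (1 + c * t) ^ p) * (1 + c) ^ ((ν : ℝ) - p) := by gcongr
      _ = _ := by ring

/-- A bound for `c ^ ν * E_ν (c t)`, uniform in `c ≥ 0` and `t ≥ 0`. -/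
theorem exists_pow_mul_besselE_bound {ν : ℕ} (hν : 1 ≤ ν) :
    ∃ C : ℝ, 0 < C ∧ ∀ c t : ℝ, 0 ≤ c → 0 ≤ t →
      |c ^ ν * besselE ν (c * t)| ≤ C * (1 + c) ^ ν * (1 + t) ^ (-(ν / 2 + 1 / 4) : ℝ) := by
  obtain ⟨C, hC, hCb⟩ := exists_besselE_bound ν
  refine ⟨C, hC, fun c t hc ht => ?_⟩
  have hν' : (1 : ℝ) ≤ ν := by exact_mod_cast hν
  rw [abs_mul, abs_of_nonneg (by positivity), mul_assoc]
  calc c ^ ν * |besselE ν (c * t)|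
      ≤ c ^ ν * (C * (1 + c * t) ^ (-(ν / 2 + 1 / 4) : ℝ)) := by
        gcongr; exact hCb _ (by positivity)
    _ = C * (c ^ ν * (1 + c * t) ^ (-(ν / 2 + 1 / 4) : ℝ)) := by ring
    _ ≤ _ := by
        gcongr C * ?_
        exact pow_mul_rpow_neg_le (by positivity) (by linarith) hc ht

/-- Decay of `E_ν (b t)` in `b`. -/
theorem exists_besselE_mul_bound (ν : ℕ) :
    ∃ C : ℝ, 0 < C ∧ ∀ b t : ℝ, 0 < b → 0 < t →
      |besselE ν (b * t)| ≤ C * b ^ (-(ν / 2 + 1 / 4) : ℝ) * t ^ (-(ν / 2 + 1 / 4) : ℝ) := by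
  obtain ⟨C, hC, hCb⟩ := exists_besselE_bound ν
  refine ⟨C, hC, fun b t hb ht => (hCb _ (by positivity)).trans ?_⟩
  rw [mul_assoc, ← Real.mul_rpow hb.le ht.le]
  gcongr C * ?_
  exact Real.rpow_le_rpow_of_nonpos (by positivity) (by linarith)
    (by have : (0 : ℝ) ≤ ν := ν.cast_nonneg; linarith)

/-! ### Explicit Laplace transforms -/

open MeasureTheory Set in
theorem integrableOn_exp_mul_of_le_pow {F : ℝ → ℝ} (hF : ContinuousOn F (Ici 0)) {C : ℝ} {k : ℕ}
    (hb : ∀ t, 0 ≤ t → |F t| ≤ C * (1 + t) ^ k) {s : ℝ} (hs : 0 < s) :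
    IntegrableOn (fun t => Real.exp (-s * t) * F t) (Ioi 0) := by
  obtain ⟨K₀, hK₀, hK₀b⟩ := exists_one_add_pow_le_exp k (show (0 : ℝ) < s / 2 by linarith)
  have hC : 0 ≤ C := by simpa using (abs_nonneg _).trans (hb 0 le_rfl)
  refine integrableOn_exp_mul_of_le_exp (K := C * K₀) hF (fun t ht => ?_)
    (show s / 2 < s by linarith)
  exact (hb t ht).trans (by rw [mul_assoc]; exact mul_le_mul_of_nonneg_left (hK₀b t ht) hC)

open MeasureTheory Set in
theorem integral_exp_neg_mul_mul_pow {s : ℝ} (hs : 0 < s) (n : ℕ) :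
    ∫ t in Ioi (0 : ℝ), Real.exp (-s * t) * t ^ n = n.factorial / s ^ (n + 1) := by
  have := Real.integral_rpow_mul_exp_neg_mul_Ioi (a := n + 1) (by positivity) hs
  rw [Real.Gamma_nat_eq_factorial, ← Nat.cast_add_one, Real.rpow_natCast] at this
  rw [one_div, inv_pow, inv_mul_eq_div] at this
  rw [← this]
  refine setIntegral_congr_fun measurableSet_Ioi fun t _ => ?_
  simp only [Nat.cast_add, Nat.cast_one, add_sub_cancel_right, Real.rpow_natCast]
  rw [neg_mul, mul_comm]

open MeasureTheory Set in
theorem integrableOn_exp_neg_mul_mul_pow {s : ℝ} (hs : 0 < s) (n : ℕ) :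
    IntegrableOn (fun t => Real.exp (-s * t) * t ^ n) (Ioi (0 : ℝ)) := by
  refine integrableOn_exp_mul_of_le_pow (C := 1) (k := n) (by fun_prop) (fun t ht => ?_) hs
  rw [abs_of_nonneg (by positivity), one_mul]
  gcongr; linarith

-- Integrating the power series termwise, the factor (k+ν)! from the moments cancels the one in the
-- coefficients, and the exponential series in -b/s remains. This is what turns the inversion s ↦
-- a/s of a theta relation into a Bessel kernel.
open MeasureTheory Set in
theorem integral_exp_neg_mul_mul_pow_mul_besselE (ν : ℕ) (b : ℝ) {s : ℝ} (hs : 0 < s) :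
    ∫ t in Ioi (0 : ℝ), Real.exp (-s * t) * (t ^ ν * besselE ν (b * t)) =
      Real.exp (-(b / s)) / s ^ (ν + 1) := by
  set f : ℕ → ℝ → ℝ := fun k t => (-1 : ℝ) ^ k / ((k.factorial : ℝ) * ((k + ν).factorial : ℝ)) *
    b ^ k * (Real.exp (-s * t) * t ^ (k + ν)) with hf
  have hval (k : ℕ) : ∫ t in Ioi (0 : ℝ), f k t = (-(b / s)) ^ k / k.factorial / s ^ (ν + 1) := by
    simp only [hf]
    rw [integral_const_mul, integral_exp_neg_mul_mul_pow hs]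
    have h2 : (0 : ℝ) < (k + ν).factorial := by exact_mod_cast (k + ν).factorial_pos
    rw [neg_pow (b / s), div_pow, show k + ν + 1 = k + (ν + 1) by ring, pow_add s k]
    field_simp
  have hnorm (k : ℕ) : ∫ t in Ioi (0 : ℝ), ‖f k t‖ = |b / s| ^ k / k.factorial / s ^ (ν + 1) := by
    have : ∀ t ∈ Ioi (0 : ℝ), ‖f k t‖ = |(-1 : ℝ) ^ k / ((k.factorial : ℝ) *
        ((k + ν).factorial : ℝ)) * b ^ k| * (Real.exp (-s * t) * t ^ (k + ν)) := by
      intro t ht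
      have ht0 : (0 : ℝ) < t := ht
      simp only [hf]
      rw [Real.norm_eq_abs, abs_mul _ (Real.exp (-s * t) * t ^ (k + ν)),
        abs_of_pos (mul_pos (Real.exp_pos _) (pow_pos ht0 _))]
    rw [setIntegral_congr_fun measurableSet_Ioi this, integral_const_mul,
      integral_exp_neg_mul_mul_pow hs]
    have h1 : (0 : ℝ) < k.factorial := by exact_mod_cast k.factorial_pos
    have h2 : (0 : ℝ) < (k + ν).factorial := by exact_mod_cast (k + ν).factorial_pos
    rw [abs_mul, abs_div, abs_pow, abs_neg, abs_one, one_pow, abs_of_pos (mul_pos h1 h2), abs_pow,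
      abs_div, abs_of_pos hs, div_pow, show k + ν + 1 = k + (ν + 1) by ring, pow_add s k]
    field_simp
  have hsum := hasSum_integral_of_summable_integral_norm (F := f) (μ := volume.restrict (Ioi 0))
    (fun k => (integrableOn_exp_neg_mul_mul_pow hs (k + ν)).const_mul _)
    (by simp_rw [hnorm]; exact (Real.summable_pow_div_factorial _).div_const _)
  simp_rw [hval] at hsum
  have hexp : HasSum (fun k : ℕ => (-(b / s)) ^ k / k.factorial / s ^ (ν + 1))
      (Real.exp (-(b / s)) / s ^ (ν + 1)) := by
    refine HasSum.div_const ?_ _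
    rw [Real.exp_eq_exp_ℝ]
    exact NormedSpace.expSeries_div_hasSum_exp _
  rw [← hsum.unique hexp]
  refine setIntegral_congr_fun measurableSet_Ioi fun t _ => ?_
  simp only [besselE]
  rw [← tsum_mul_left, ← tsum_mul_left]
  refine tsum_congr fun k => ?_
  simp only [hf]
  rw [mul_pow, pow_add]; ring

/-! ### Weber-Schafheitlin integrals -/

theorem exists_sq_mul_besselE_two_bound :
    ∃ C : ℝ, 0 < C ∧ ∀ b t : ℝ, 0 < b → 0 < t →
      |t ^ 2 * besselE 2 (b * t)| ≤ C * b ^ (-(5 / 4) : ℝ) * (1 + t) ^ (3 / 4 : ℝ) := by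
  obtain ⟨C, hC, hCb⟩ := exists_besselE_mul_bound 2
  refine ⟨C, hC, fun b t hb ht => ?_⟩
  have h := hCb b t hb ht
  rw [show (-(((2 : ℕ) : ℝ) / 2 + 1 / 4) : ℝ) = -(5 / 4) by norm_num] at h
  rw [abs_mul, abs_of_pos (by positivity)]
  calc t ^ 2 * |besselE 2 (b * t)|
      ≤ t ^ 2 * (C * b ^ (-(5 / 4) : ℝ) * t ^ (-(5 / 4) : ℝ)) := by gcongr
    _ = C * b ^ (-(5 / 4) : ℝ) * t ^ (3 / 4 : ℝ) := by
        have : t ^ (3 / 4 : ℝ) = t ^ (2 : ℕ) * t ^ (-(5 / 4) : ℝ) := by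
          rw [← Real.rpow_natCast, ← Real.rpow_add ht]; norm_num
        rw [this]; ring
    _ ≤ _ := by
        gcongr; linarith

/-- Order 4 is taken because t^(3/4) t^(-9/4) = t^(-3/2) is integrable at infinity; the order 3
wanted in the end gives only t^(-1), hence the detour through `lommel`. -/
theorem exists_weber_integrand_bound :
    ∃ C : ℝ, 0 < C ∧ ∀ b c t : ℝ, 0 < b → 0 ≤ c → 0 < t →
      |t ^ 2 * besselE 2 (b * t) * (c ^ 4 * besselE 4 (c * t))| ≤
        C * b ^ (-(5 / 4) : ℝ) * (1 + c) ^ 4 * (1 + t) ^ (-(3 / 2) : ℝ) := by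
  obtain ⟨C, hC, hCb⟩ := exists_sq_mul_besselE_two_bound
  obtain ⟨C', hC', hCb'⟩ := exists_pow_mul_besselE_bound (ν := 4) (by norm_num)
  refine ⟨C * C', by positivity, fun b c t hb hc ht => ?_⟩
  have h := hCb' c t hc ht.le
  rw [show (-(((4 : ℕ) : ℝ) / 2 + 1 / 4) : ℝ) = -(9 / 4) by norm_num] at h
  have e : (1 + t) ^ (-(3 / 2) : ℝ) = (1 + t) ^ (3 / 4 : ℝ) * (1 + t) ^ (-(9 / 4) : ℝ) := by
    rw [← Real.rpow_add (by positivity)]; norm_num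
  rw [abs_mul, e]
  calc _ ≤ (C * b ^ (-(5 / 4) : ℝ) * (1 + t) ^ (3 / 4 : ℝ)) *
        (C' * (1 + c) ^ 4 * (1 + t) ^ (-(9 / 4) : ℝ)) :=
        mul_le_mul (hCb b t hb ht) h (abs_nonneg _) (by positivity)
    _ = _ := by ring

open MeasureTheory Set in
theorem integrableOn_one_add_rpow_neg :
    IntegrableOn (fun t : ℝ => (1 + t) ^ (-(3 / 2) : ℝ)) (Ioi 0) := by
  have := integrableOn_add_rpow_Ioi_of_lt (a := -(3 / 2)) (c := 0) (m := 1) (by norm_num)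
    (by norm_num)
  simpa [add_comm] using this

open MeasureTheory Set in
theorem integral_exp_neg_mul_mul_max_sub {s : ℝ} (hs : 0 < s) {b : ℝ} (hb : 0 ≤ b) :
    ∫ t in Ioi (0 : ℝ), Real.exp (-s * t) * max (t - b) 0 = Real.exp (-(b * s)) / s ^ 2 := by
  have h := integral_exp_neg_mul_mul_pow hs 1
  rw [← integral_indicator measurableSet_Ioi, ← integral_sub_right_eq_self _ b] at h
  rw [← integral_indicator measurableSet_Ioi, ← mul_one (Real.exp (-(b * s))), mul_div_assoc]
  simp only [Nat.factorial_one, Nat.cast_one, pow_one] at h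
  rw [← h, ← integral_const_mul]
  congr 1
  ext t
  simp only [indicator, mem_Ioi]
  split_ifs with h1 h2 h2
  · rw [max_eq_left (by linarith), show -s * t = -(b * s) + -s * (t - b) by ring, Real.exp_add]
    ring
  · rw [max_eq_right (by linarith)]; simp
  · exfalso; linarith
  · simp

open MeasureTheory Set in
theorem integrableOn_weber {b c : ℝ} (hb : 0 < b) (hc : 0 ≤ c) :
    IntegrableOn (fun t => t ^ 2 * besselE 2 (b * t) * (c ^ 4 * besselE 4 (c * t))) (Ioi 0) := by
  obtain ⟨C, hC, hCb⟩ := exists_weber_integrand_bound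
  have h2 := continuous_besselE 2
  have h4 := continuous_besselE 4
  refine Integrable.mono' (integrableOn_one_add_rpow_neg.const_mul
    (C * b ^ (-(5 / 4) : ℝ) * (1 + c) ^ 4)) (by fun_prop) ?_
  exact (ae_restrict_mem measurableSet_Ioi).mono fun t ht => hCb b c t hb hc ht

open MeasureTheory Set in
/-- A Weber-Schafheitlin integral. -/
theorem integral_weber {b c : ℝ} (hb : 0 < b) (hc : 0 < c) :
    ∫ t in Ioi (0 : ℝ), t ^ 2 * besselE 2 (b * t) * (c ^ 4 * besselE 4 (c * t)) =
      max (c - b) 0 := by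
  obtain ⟨C, hC, hCb⟩ := exists_weber_integrand_bound
  have h2 := continuous_besselE 2
  have h4 := continuous_besselE 4
  set B := C * b ^ (-(5 / 4) : ℝ) with hB
  set M := ∫ t in Ioi (0 : ℝ), (1 + t) ^ (-(3 / 2) : ℝ) with hM
  set F : ℝ → ℝ := fun c =>
    ∫ t in Ioi (0 : ℝ), t ^ 2 * besselE 2 (b * t) * (c ^ 4 * besselE 4 (c * t)) with hF
  have hFc : ContinuousOn F (Ici 0) := by
    intro c₀ hc₀
    have hc₀' : 0 ≤ c₀ := hc₀
    refine continuousWithinAt_of_dominated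
      (bound := fun t => B * (1 + (c₀ + 1)) ^ 4 * (1 + t) ^ (-(3 / 2) : ℝ)) ?_ ?_
      (integrableOn_one_add_rpow_neg.const_mul _) ?_
    · exact Eventually.of_forall fun c => by fun_prop
    · filter_upwards [self_mem_nhdsWithin,
        mem_nhdsWithin_of_mem_nhds (Iio_mem_nhds (show c₀ < c₀ + 1 by linarith))] with c hc hc1
      have hc' : 0 ≤ c := hc
      have hc1' : c < c₀ + 1 := hc1
      refine (ae_restrict_mem measurableSet_Ioi).mono fun t ht => ?_
      have ht' : 0 < t := ht
      refine (hCb b c t hb hc ht).trans ?_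
      gcongr
    · exact Eventually.of_forall fun t => by
        apply Continuous.continuousWithinAt; fun_prop
  have hFb (c : ℝ) (hc : 0 ≤ c) : |F c| ≤ B * M * (1 + c) ^ 4 := by
    rw [← Real.norm_eq_abs]
    refine (norm_integral_le_of_norm_le (integrableOn_one_add_rpow_neg.const_mul
      (B * (1 + c) ^ 4)) ((ae_restrict_mem measurableSet_Ioi).mono fun t ht => ?_)).trans_eq ?_
    · exact hCb b c t hb hc ht
    · rw [integral_const_mul]; ring
  have hmax (c : ℝ) (hc : 0 ≤ c) : |max (c - b) 0| ≤ 1 * (1 + c) ^ 4 := by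
    rw [abs_of_nonneg (le_max_right _ _), one_mul]
    refine max_le ?_ (by positivity)
    have : 1 + c ≤ (1 + c) ^ 4 := le_self_pow₀ (by linarith) (by norm_num)
    linarith
  have hmaxc : ContinuousOn (fun c : ℝ => max (c - b) 0) (Ici 0) := by fun_prop
  -- Transforming in c replaces c⁴ E_4(ct) by e^(-t/s)/s⁵. The remaining t-integral is again a
  -- Laplace transform, now at 1/s, and equals s³ e^(-bs). The product e^(-bs)/s² is the transform
  -- of (c-b)₊.
  have hLap (s : ℝ) (hs : 0 < s) :
      ∫ c in Ioi (0 : ℝ), Real.exp (-s * c) * F c = Real.exp (-(b * s)) / s ^ 2 := by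
    simp only [hF, ← integral_const_mul]
    rw [integral_integral_swap]
    · have hin (t : ℝ) : ∫ c in Ioi (0 : ℝ), Real.exp (-s * c) *
          (t ^ 2 * besselE 2 (b * t) * (c ^ 4 * besselE 4 (c * t))) =
          1 / s ^ 5 * (Real.exp (-(1 / s) * t) * (t ^ 2 * besselE 2 (b * t))) := by
        have := integral_exp_neg_mul_mul_pow_mul_besselE 4 t hs
        rw [show 1 / s ^ 5 * (Real.exp (-(1 / s) * t) * (t ^ 2 * besselE 2 (b * t))) =
          (t ^ 2 * besselE 2 (b * t)) * (Real.exp (-(t / s)) / s ^ (4 + 1)) by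
            rw [show -(1 / s) * t = -(t / s) by ring]; ring, ← this, ← integral_const_mul]
        refine setIntegral_congr_fun measurableSet_Ioi fun c _ => ?_
        simp only [mul_comm t c]
        ring
      simp_rw [hin]
      rw [integral_const_mul, integral_exp_neg_mul_mul_pow_mul_besselE 2 b (one_div_pos.2 hs)]
      field_simp
      rw [one_div, inv_pow, mul_inv_cancel₀ (pow_ne_zero 3 hs.ne')]
    · rw [Function.uncurry_def]
      have hE : IntegrableOn (fun c : ℝ => Real.exp (-s * c) * (1 + c) ^ 4) (Ioi 0) :=
        integrableOn_exp_mul_of_le_pow (C := 1) (k := 4) (by fun_prop)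
          (fun t ht => by rw [abs_of_nonneg (by positivity), one_mul]) hs
      have hprod := (Integrable.mul_prod hE integrableOn_one_add_rpow_neg).const_mul B
      refine Integrable.mono' hprod (by fun_prop) ?_
      rw [Measure.prod_restrict]
      refine (ae_restrict_mem (measurableSet_Ioi.prod measurableSet_Ioi)).mono fun p hp => ?_
      have h1 := hCb b p.1 p.2 hb (le_of_lt hp.1) hp.2
      rw [Real.norm_eq_abs, abs_mul, Real.abs_exp]
      calc _ ≤ Real.exp (-s * p.1) * (B * (1 + p.1) ^ 4 * (1 + p.2) ^ (-(3 / 2) : ℝ)) := by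
            gcongr
        _ = _ := by ring
  have hzero := eq_zero_of_laplace_eq_zero (F := fun c => F c - max (c - b) 0)
    (C := B * M + 1) (k := 4) (hFc.sub hmaxc) (fun c hc => ?_) (fun s hs => ?_) hc
  · exact sub_eq_zero.1 hzero
  · refine (abs_sub _ _).trans ?_
    rw [add_mul]
    exact add_le_add (hFb c hc) (hmax c hc)
  · simp_rw [mul_sub]
    rw [integral_sub (integrableOn_exp_mul_of_le_pow hFc hFb hs)
      (integrableOn_exp_mul_of_le_pow hmaxc hmax hs), hLap s hs,
      integral_exp_neg_mul_mul_max_sub hs hb.le, sub_self]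

/-- The Lommel antiderivative for `E_2 (b t) * E_3 (c t)`. -/
def lommel (b c t : ℝ) : ℝ :=
  t ^ 3 * (c * besselE 2 (b * t) * besselE 4 (c * t) - b * besselE 3 (b * t) * besselE 3 (c * t))

/-- The product rule produces E_4(bt) and E_5(ct), which the recurrence eliminates. Integrated, it
trades the conditionally convergent E_2 E_3 integral for the absolutely convergent E_2 E_4 one, at
the price of the factor c - b. -/
theorem hasDerivAt_lommel (b c t : ℝ) :
    HasDerivAt (lommel b c) ((c - b) * (t ^ 2 * besselE 2 (b * t) * besselE 3 (c * t)) -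
      c * (t ^ 2 * besselE 2 (b * t) * besselE 4 (c * t))) t := by
  have h2 := hasDerivAt_besselE_mul 2 b t
  have h3 := hasDerivAt_besselE_mul 3 b t
  have k3 := hasDerivAt_besselE_mul 3 c t
  have k4 := hasDerivAt_besselE_mul 4 c t
  refine ((hasDerivAt_pow 3 t).mul (((h2.const_mul c).mul k4).sub
    ((h3.const_mul b).mul k3))).congr_deriv ?_
  have r2 := mul_besselE_add_two 2 (b * t)
  have r3 := mul_besselE_add_two 3 (c * t)
  norm_num at r2 r3 ⊢
  linear_combination (t ^ 2 * b * besselE 3 (c * t)) * r2 -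
    (t ^ 2 * c * besselE 2 (b * t)) * r3

theorem exists_lommel_bound {c : ℝ} (hc : 0 < c) :
    ∃ C : ℝ, 0 < C ∧ ∀ b t : ℝ, 0 < b → 0 < t →
      |lommel b c t| ≤ C * (b ^ (-(3 / 4) : ℝ) + b ^ (-(5 / 4) : ℝ)) * t ^ (-(1 / 2) : ℝ) := by
  obtain ⟨C2, hC2, h2⟩ := exists_besselE_mul_bound 2
  obtain ⟨C3, hC3, h3⟩ := exists_besselE_mul_bound 3
  obtain ⟨C4, hC4, h4⟩ := exists_besselE_mul_bound 4
  have e2 : (-(((2 : ℕ) : ℝ) / 2 + 1 / 4) : ℝ) = -(5 / 4) := by norm_num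
  have e3 : (-(((3 : ℕ) : ℝ) / 2 + 1 / 4) : ℝ) = -(7 / 4) := by norm_num
  have e4 : (-(((4 : ℕ) : ℝ) / 2 + 1 / 4) : ℝ) = -(9 / 4) := by norm_num
  rw [e2] at h2; rw [e3] at h3; rw [e4] at h4
  set A := c * C2 * (C4 * c ^ (-(9 / 4) : ℝ)) with hA
  set B := C3 * (C3 * c ^ (-(7 / 4) : ℝ)) with hB
  have hA0 : 0 < A := by positivity
  have hB0 : 0 < B := by positivity
  refine ⟨A + B, by positivity, fun b t hb ht => ?_⟩
  have p1 : t ^ 3 * (t ^ (-(5 / 4) : ℝ) * t ^ (-(9 / 4) : ℝ)) = t ^ (-(1 / 2) : ℝ) := by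
    rw [← Real.rpow_natCast, ← Real.rpow_add ht, ← Real.rpow_add ht]; norm_num
  have p2 : t ^ 3 * (t ^ (-(7 / 4) : ℝ) * t ^ (-(7 / 4) : ℝ)) = t ^ (-(1 / 2) : ℝ) := by
    rw [← Real.rpow_natCast, ← Real.rpow_add ht, ← Real.rpow_add ht]; norm_num
  have p3 : b * b ^ (-(7 / 4) : ℝ) = b ^ (-(3 / 4) : ℝ) := by
    nth_rewrite 1 [← Real.rpow_one b]
    rw [← Real.rpow_add hb]; norm_num
  have q1 : |c * besselE 2 (b * t) * besselE 4 (c * t)| ≤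
      A * b ^ (-(5 / 4) : ℝ) * (t ^ (-(5 / 4) : ℝ) * t ^ (-(9 / 4) : ℝ)) := by
    rw [abs_mul, abs_mul, abs_of_pos hc]
    calc _ ≤ c * (C2 * b ^ (-(5 / 4) : ℝ) * t ^ (-(5 / 4) : ℝ)) *
          (C4 * c ^ (-(9 / 4) : ℝ) * t ^ (-(9 / 4) : ℝ)) := by
          gcongr
          · exact h2 b t hb ht
          · exact h4 c t hc ht
      _ = _ := by rw [hA]; ring
  have q2 : |b * besselE 3 (b * t) * besselE 3 (c * t)| ≤
      B * b ^ (-(3 / 4) : ℝ) * (t ^ (-(7 / 4) : ℝ) * t ^ (-(7 / 4) : ℝ)) := by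
    rw [abs_mul, abs_mul, abs_of_pos hb]
    calc _ ≤ b * (C3 * b ^ (-(7 / 4) : ℝ) * t ^ (-(7 / 4) : ℝ)) *
          (C3 * c ^ (-(7 / 4) : ℝ) * t ^ (-(7 / 4) : ℝ)) := by
          gcongr
          · exact h3 b t hb ht
          · exact h3 c t hc ht
      _ = _ := by rw [hB, ← p3]; ring
  rw [lommel, abs_mul, abs_of_pos (pow_pos ht 3)]
  calc _ ≤ t ^ 3 * (A * b ^ (-(5 / 4) : ℝ) * (t ^ (-(5 / 4) : ℝ) * t ^ (-(9 / 4) : ℝ)) +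
        B * b ^ (-(3 / 4) : ℝ) * (t ^ (-(7 / 4) : ℝ) * t ^ (-(7 / 4) : ℝ))) := by
        gcongr
        exact (abs_sub _ _).trans (add_le_add q1 q2)
    _ = A * b ^ (-(5 / 4) : ℝ) * (t ^ 3 * (t ^ (-(5 / 4) : ℝ) * t ^ (-(9 / 4) : ℝ))) +
        B * b ^ (-(3 / 4) : ℝ) * (t ^ 3 * (t ^ (-(7 / 4) : ℝ) * t ^ (-(7 / 4) : ℝ))) := by ring
    _ = (A * b ^ (-(5 / 4) : ℝ) + B * b ^ (-(3 / 4) : ℝ)) * t ^ (-(1 / 2) : ℝ) := by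
        rw [p1, p2]; ring
    _ ≤ _ := by
        gcongr
        have : 0 ≤ A * b ^ (-(3 / 4) : ℝ) := by positivity
        have : 0 ≤ B * b ^ (-(5 / 4) : ℝ) := by positivity
        linarith

/-- A truncated discontinuous integral of Weber and Schafheitlin. -/
def discontIntegral (b c T : ℝ) : ℝ :=
  ∫ t in (0 : ℝ)..T, t ^ 2 * besselE 2 (b * t) * (c ^ 3 * besselE 3 (c * t))

theorem sub_mul_discontIntegral (b c T : ℝ) :
    (c - b) * discontIntegral b c T = c ^ 3 * lommel b c T +
      ∫ t in (0 : ℝ)..T, t ^ 2 * besselE 2 (b * t) * (c ^ 4 * besselE 4 (c * t)) := by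
  have h2 := continuous_besselE 2
  have h3 := continuous_besselE 3
  have h4 := continuous_besselE 4
  have h := intervalIntegral.integral_eq_sub_of_hasDerivAt (a := 0) (b := T)
    (fun t _ => hasDerivAt_lommel b c t) (Continuous.intervalIntegrable (by fun_prop) _ _)
  rw [intervalIntegral.integral_sub (Continuous.intervalIntegrable (by fun_prop) _ _)
    (Continuous.intervalIntegrable (by fun_prop) _ _), intervalIntegral.integral_const_mul,
    intervalIntegral.integral_const_mul] at h
  have h0 : lommel b c 0 = 0 := by simp [lommel]
  rw [h0, sub_zero] at h
  have e3 : discontIntegral b c T =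
      c ^ 3 * ∫ t in (0 : ℝ)..T, t ^ 2 * besselE 2 (b * t) * besselE 3 (c * t) := by
    rw [discontIntegral, ← intervalIntegral.integral_const_mul]
    congr 1; ext t; ring
  have e4 : ∫ t in (0 : ℝ)..T, t ^ 2 * besselE 2 (b * t) * (c ^ 4 * besselE 4 (c * t)) =
      c ^ 4 * ∫ t in (0 : ℝ)..T, t ^ 2 * besselE 2 (b * t) * besselE 4 (c * t) := by
    rw [← intervalIntegral.integral_const_mul]
    congr 1; ext t; ring
  rw [e3, e4]
  linear_combination c ^ 3 * h

-- Both terms of `sub_mul_discontIntegral` are bounded uniformly in T. For large b the result is of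
-- size b^(-7/4), which is summable against r(n) at b = an.
open MeasureTheory Set in
theorem exists_discontIntegral_bound {c : ℝ} (hc : 0 < c) :
    ∃ C : ℝ, 0 < C ∧ ∀ b T : ℝ, 0 < b → b ≠ c → 1 ≤ T →
      |discontIntegral b c T| ≤ C * (b ^ (-(3 / 4) : ℝ) + b ^ (-(5 / 4) : ℝ)) / |b - c| := by
  obtain ⟨C, hC, hCb⟩ := exists_lommel_bound hc
  obtain ⟨C', hC', hCb'⟩ := exists_weber_integrand_bound
  set M := ∫ t in Ioi (0 : ℝ), (1 + t) ^ (-(3 / 2) : ℝ) with hM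
  have hM0 : 0 ≤ M := setIntegral_nonneg measurableSet_Ioi fun t ht => by
    have : (0 : ℝ) < t := ht
    positivity
  refine ⟨c ^ 3 * C + C' * (1 + c) ^ 4 * M, by positivity, fun b T hb hbc hT => ?_⟩
  have hT0 : 0 < T := by linarith
  rw [le_div_iff₀ (abs_pos.2 (sub_ne_zero.2 hbc)), mul_comm, abs_sub_comm, ← abs_mul,
    sub_mul_discontIntegral]
  have h1 : |lommel b c T| ≤ C * (b ^ (-(3 / 4) : ℝ) + b ^ (-(5 / 4) : ℝ)) := by
    refine (hCb b T hb hT0).trans (mul_le_of_le_one_right (by positivity) ?_)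
    exact Real.rpow_le_one_of_one_le_of_nonpos hT (by norm_num)
  have h2 : |∫ t in (0 : ℝ)..T, t ^ 2 * besselE 2 (b * t) * (c ^ 4 * besselE 4 (c * t))| ≤
      C' * b ^ (-(5 / 4) : ℝ) * (1 + c) ^ 4 * M := by
    have hi : IntegrableOn (fun t : ℝ => C' * b ^ (-(5 / 4) : ℝ) * (1 + c) ^ 4 *
        (1 + t) ^ (-(3 / 2) : ℝ)) (Ioi 0) := integrableOn_one_add_rpow_neg.const_mul _
    rw [intervalIntegral.integral_of_le hT0.le, ← Real.norm_eq_abs, hM, ← integral_const_mul]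
    refine (norm_integral_le_of_norm_le (hi.mono_set Ioc_subset_Ioi_self)
      ((ae_restrict_mem measurableSet_Ioc).mono fun t ht => hCb' b c t hb hc.le ht.1)).trans ?_
    refine setIntegral_mono_set hi ((ae_restrict_mem measurableSet_Ioi).mono fun t ht => ?_)
      Ioc_subset_Ioi_self.eventuallyLE
    have : (0 : ℝ) < t := ht
    simp only [Pi.zero_apply]
    positivity
  refine (abs_add_le _ _).trans ?_
  rw [abs_mul, abs_of_pos (pow_pos hc 3)]
  calc _ ≤ c ^ 3 * (C * (b ^ (-(3 / 4) : ℝ) + b ^ (-(5 / 4) : ℝ))) +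
        C' * b ^ (-(5 / 4) : ℝ) * (1 + c) ^ 4 * M := by gcongr
    _ ≤ _ := by
        have : 0 ≤ C' * (1 + c) ^ 4 * M * b ^ (-(3 / 4) : ℝ) := by positivity
        linarith

-- The Lommel term is O(T^(-1/2)), so the limit is (c-b)₊/(c-b).
open MeasureTheory Set in
theorem tendsto_discontIntegral_of_ne {b c : ℝ} (hb : 0 < b) (hc : 0 < c) (hbc : b ≠ c) :
    Tendsto (discontIntegral b c) atTop (𝓝 (if b < c then 1 else 0)) := by
  obtain ⟨C, hC, hCb⟩ := exists_lommel_bound hc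
  have hL : Tendsto (lommel b c) atTop (𝓝 0) := by
    refine squeeze_zero_norm' ((eventually_gt_atTop 0).mono fun t ht => hCb b t hb ht) ?_
    rw [← mul_zero (C * (b ^ (-(3 / 4) : ℝ) + b ^ (-(5 / 4) : ℝ)))]
    exact (tendsto_rpow_neg_atTop (by norm_num : (0 : ℝ) < 1 / 2)).const_mul _
  have hW := intervalIntegral_tendsto_integral_Ioi 0 (integrableOn_weber hb hc.le) tendsto_id
  rw [integral_weber hb hc] at hW
  have h := ((hL.const_mul (c ^ 3)).add hW).div_const (c - b)
  have hne : c - b ≠ 0 := sub_ne_zero.2 hbc.symm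
  have hv : (c ^ 3 * 0 + max (c - b) 0) / (c - b) = if b < c then 1 else 0 := by
    split_ifs with hlt
    · rw [max_eq_left (by linarith), mul_zero, zero_add, div_self hne]
    · rw [max_eq_right (by linarith), mul_zero, zero_add, zero_div]
  rw [hv] at h
  refine h.congr fun T => ?_
  rw [id, ← sub_mul_discontIntegral, mul_div_cancel_left₀ _ hne]

/-- At b = c the Lommel identity loses the integral, so an explicit antiderivative is used. As y^ν
E_ν(y)² = J_ν(2√y)², it is -J_2² - J_1² - J_0²/2, which is -1/2 at the origin and tends to 0 at
infinity. -/
theorem tendsto_discontIntegral_self {c : ℝ} (hc : 0 < c) :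
    Tendsto (discontIntegral c c) atTop (𝓝 (1 / 2)) := by
  set P : ℝ → ℝ := fun t => -((c * t ) ^ 2 * besselE 2 (c * t) ^ 2) -
    (c * t) * besselE 1 (c * t) ^ 2 - besselE 0 (c * t) ^ 2 / 2 with hP
  have h2 := continuous_besselE 2
  have h3 := continuous_besselE 3
  have hd (t : ℝ) : HasDerivAt P (t ^ 2 * besselE 2 (c * t) * (c ^ 3 * besselE 3 (c * t))) t := by
    have h0 := hasDerivAt_besselE_mul 0 c t
    have h1 := hasDerivAt_besselE_mul 1 c t
    have h2 := hasDerivAt_besselE_mul 2 c t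
    have ht := (hasDerivAt_id t).const_mul c
    refine ((((ht.pow 2).mul (h2.pow 2)).neg.sub (ht.mul (h1.pow 2))).sub
      ((h0.pow 2).div_const 2)).congr_deriv ?_
    have r0 := mul_besselE_add_two 0 (c * t)
    have r1 := mul_besselE_add_two 1 (c * t)
    norm_num at r0 r1 ⊢
    linear_combination (c * (c * t) * besselE 2 (c * t)) * r1 + c * besselE 1 (c * t) * r0
  have hI (T : ℝ) : discontIntegral c c T = P T + 1 / 2 := by
    rw [discontIntegral, intervalIntegral.integral_eq_sub_of_hasDerivAt (fun t _ => hd t)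
      (Continuous.intervalIntegrable (by fun_prop) _ _)]
    simp [hP, besselE_zero_right]
  have hdec (ν : ℕ) : Tendsto (fun y : ℝ => y ^ ν * besselE ν y ^ 2) atTop (𝓝 0) := by
    obtain ⟨C, hC, hCb⟩ := exists_besselE_bound_of_one_le ν
    refine squeeze_zero_norm' (a := fun y => C ^ 2 * y ^ (-(1 / 2) : ℝ)) ?_ ?_
    · filter_upwards [eventually_ge_atTop 1] with y hy
      have hy0 : 0 < y := by linarith
      rw [Real.norm_eq_abs, abs_mul, abs_pow, abs_pow, abs_of_pos hy0]
      calc y ^ ν * |besselE ν y| ^ 2 ≤ y ^ ν * (C * y ^ (-(ν / 2 + 1 / 4) : ℝ)) ^ 2 := by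
            gcongr; exact hCb y hy
        _ = C ^ 2 * (y ^ (ν : ℝ) * (y ^ (-(ν / 2 + 1 / 4) : ℝ)) ^ (2 : ℕ)) := by
            rw [Real.rpow_natCast]; ring
        _ = _ := by
            rw [← Real.rpow_natCast (_ ^ _) 2, ← Real.rpow_mul hy0.le, ← Real.rpow_add hy0]
            congr 2; push_cast; ring
    · rw [← mul_zero (C ^ 2)]
      exact (tendsto_rpow_neg_atTop (by norm_num : (0 : ℝ) < 1 / 2)).const_mul _
  have hlim : Tendsto (fun T => P T + 1 / 2) atTop (𝓝 (-0 - 0 - 0 / 2 + 1 / 2)) := by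
    have hct : Tendsto (fun T : ℝ => c * T) atTop atTop := tendsto_id.const_mul_atTop hc
    have d2 := (hdec 2).comp hct
    have d1 := (hdec 1).comp hct
    have d0 := (hdec 0).comp hct
    refine (((d2.neg.sub d1).sub (d0.div_const 2)).add_const (1 / 2)).congr fun T => ?_
    simp [hP]
  simpa [funext hI] using hlim

/-! ### Series of functions of polynomial growth and their Laplace transforms -/

open MeasureTheory Set in
theorem continuousOn_tsum_of_le_mul_pow {f : ℕ → ℝ → ℝ} {u : ℕ → ℝ} {k : ℕ}
    (hf : ∀ n, ContinuousOn (f n) (Ici 0)) (hu : Summable u)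
    (hfu : ∀ n t, 0 ≤ t → |f n t| ≤ u n * (1 + t) ^ k) :
    ContinuousOn (fun t => ∑' n, f n t) (Ici 0) := by
  have hu0 (n : ℕ) : 0 ≤ u n := by simpa using (abs_nonneg _).trans (hfu n 0 le_rfl)
  intro t₀ ht₀
  have h : ContinuousOn (fun t => ∑' n, f n t) (Icc 0 (t₀ + 1)) := by
    refine continuousOn_tsum (u := fun n => u n * (1 + (t₀ + 1)) ^ k)
      (fun n => (hf n).mono Icc_subset_Ici_self) (hu.mul_right _) fun n t ht => ?_
    refine (hfu n t ht.1).trans ?_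
    have := ht.1
    have := ht.2
    have := hu0 n
    gcongr
  have ht₀' : 0 ≤ t₀ := ht₀
  refine (h t₀ ⟨ht₀, by linarith⟩).mono_of_mem_nhdsWithin ?_
  have := inter_mem_nhdsWithin (Ici (0 : ℝ)) (Iio_mem_nhds (show t₀ < t₀ + 1 by linarith))
  exact mem_of_superset this fun t ht => ⟨ht.1, le_of_lt ht.2⟩

theorem abs_tsum_le_of_le_mul_pow {f : ℕ → ℝ → ℝ} {u : ℕ → ℝ} {k : ℕ} (hu : Summable u)
    (hfu : ∀ n t, 0 ≤ t → |f n t| ≤ u n * (1 + t) ^ k) {t : ℝ} (ht : 0 ≤ t) :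
    |∑' n, f n t| ≤ (∑' n, u n) * (1 + t) ^ k := by
  rw [← tsum_mul_right, ← Real.norm_eq_abs]
  exact tsum_of_norm_bounded (hu.mul_right _).hasSum fun n => hfu n t ht

open MeasureTheory Set in
theorem laplace_tsum {f : ℕ → ℝ → ℝ} {u : ℕ → ℝ} {k : ℕ}
    (hf : ∀ n, ContinuousOn (f n) (Ici 0)) (hu : Summable u)
    (hfu : ∀ n t, 0 ≤ t → |f n t| ≤ u n * (1 + t) ^ k) {s : ℝ} (hs : 0 < s) :
    ∫ t in Ioi (0 : ℝ), Real.exp (-s * t) * ∑' n, f n t =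
      ∑' n, ∫ t in Ioi (0 : ℝ), Real.exp (-s * t) * f n t := by
  simp_rw [← tsum_mul_left]
  have hp : IntegrableOn (fun t : ℝ => Real.exp (-s * t) * (1 + t) ^ k) (Ioi 0) :=
    integrableOn_exp_mul_of_le_pow (C := 1) (k := k) (by fun_prop)
      (fun t ht => by rw [abs_of_nonneg (by positivity), one_mul]) hs
  have hi (n : ℕ) := integrableOn_exp_mul_of_le_pow (hf n) (hfu n) hs
  refine (hasSum_integral_of_summable_integral_norm hi ?_).tsum_eq.symm
  refine Summable.of_nonneg_of_le (fun n => integral_nonneg fun t => norm_nonneg _) (fun n => ?_)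
    (hu.mul_right (∫ t in Ioi (0 : ℝ), Real.exp (-s * t) * (1 + t) ^ k))
  rw [← integral_const_mul]
  refine setIntegral_mono_on (hi n).norm (hp.const_mul _) measurableSet_Ioi fun t ht => ?_
  have ht0 : 0 < t := ht
  rw [Real.norm_eq_abs, abs_mul, Real.abs_exp]
  calc _ ≤ Real.exp (-s * t) * (u n * (1 + t) ^ k) := by gcongr; exact hfu n t ht0.le
    _ = _ := by ring

/-! ### Self-dual theta series and the Riesz mean of order one -/

/-- A nonnegative sequence whose theta series `∑ r n * exp (-n s)` satisfies the functional
equation of weight one that relates `s` and `a / s`. -/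
structure SelfDualTheta (r : ℕ → ℝ) (a : ℝ) : Prop where
  nonneg : ∀ n, 0 ≤ r n
  pos : 0 < a
  summable : ∀ s : ℝ, 0 < s → Summable fun n : ℕ => r n * Real.exp (-(n * s))
  feq : ∀ s : ℝ, 0 < s → ∑' n : ℕ, r n * Real.exp (-(n * s)) =
    √a / s * ∑' n : ℕ, r n * Real.exp (-(n * (a / s)))

namespace SelfDualTheta

variable {r : ℕ → ℝ} {a : ℝ}

/-- Take s = 1/N: for n ≤ N the weight e^(-n/N) is at least e^(-1), while the functional equation
gives θ(1/N) = √a N θ(aN) ≤ √a N θ(a). -/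
theorem exists_sum_range_le (h : SelfDualTheta r a) :
    ∃ C : ℝ, 0 ≤ C ∧ ∀ N : ℕ, 1 ≤ N → ∑ n ∈ Finset.range (N + 1), r n ≤ C * N := by
  set Θ := ∑' n : ℕ, r n * Real.exp (-(n * a)) with hΘ
  have hr := h.nonneg
  have ha := h.pos
  have hΘ0 : 0 ≤ Θ := tsum_nonneg fun n => mul_nonneg (hr n) (Real.exp_pos _).le
  refine ⟨Real.exp 1 * √a * Θ, by positivity, fun N hN => ?_⟩
  have hN0 : (0 : ℝ) < N := by exact_mod_cast hN
  have hN1 : (1 : ℝ) ≤ N := by exact_mod_cast hN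
  have h1 : ∑ n ∈ Finset.range (N + 1), r n ≤
      Real.exp 1 * ∑ n ∈ Finset.range (N + 1), r n * Real.exp (-(n * (1 / N : ℝ))) := by
    rw [Finset.mul_sum]
    refine Finset.sum_le_sum fun n hn => ?_
    have hnN : (n : ℝ) ≤ N := by exact_mod_cast Finset.mem_range_succ_iff.1 hn
    rw [mul_left_comm, ← Real.exp_add]
    refine le_mul_of_one_le_right (hr n) (Real.one_le_exp ?_)
    have : (n : ℝ) * (1 / N) ≤ 1 := by rw [mul_one_div]; exact (div_le_one hN0).2 hnN
    linarith
  have h2 : ∑ n ∈ Finset.range (N + 1), r n * Real.exp (-(n * (1 / N : ℝ))) ≤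
      ∑' n : ℕ, r n * Real.exp (-(n * (1 / N : ℝ))) :=
    (h.summable _ (by positivity)).sum_le_tsum _
      fun n _ => mul_nonneg (hr n) (Real.exp_pos _).le
  rw [h.feq _ (by positivity)] at h2
  have h3 : ∑' n : ℕ, r n * Real.exp (-(n * (a / (1 / N : ℝ)))) ≤ Θ := by
    refine (h.summable _ (by positivity)).tsum_le_tsum (fun n => ?_) (h.summable _ ha)
    have := hr n
    gcongr
    rw [div_div_eq_mul_div, div_one]
    exact le_mul_of_one_le_right ha.le hN1
  calc _ ≤ Real.exp 1 * (√a / (1 / N) * Θ) := by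
        refine h1.trans ?_
        gcongr
        refine h2.trans ?_
        gcongr
    _ = _ := by field_simp

theorem summable_rpow (h : SelfDualTheta r a) {σ : ℝ} (hσ : 1 < σ) :
    Summable fun n : ℕ => r n * (n : ℝ) ^ (-σ) := by
  obtain ⟨C, hC, hCb⟩ := h.exists_sum_range_le
  have hO : (fun n ↦ ∑ k ∈ Finset.Icc 1 n, r k) =O[atTop] fun n : ℕ ↦ (n : ℝ) ^ (1 : ℝ) := by
    refine Asymptotics.IsBigO.of_bound C ?_
    filter_upwards [eventually_ge_atTop 1] with N hN
    rw [Real.norm_of_nonneg (Finset.sum_nonneg fun n _ => h.nonneg n), Real.rpow_one,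
      Real.norm_of_nonneg (Nat.cast_nonneg N)]
    refine le_trans (Finset.sum_le_sum_of_subset_of_nonneg (fun n hn => ?_)
      fun n _ _ => h.nonneg n) (hCb N hN)
    simp only [Finset.mem_Icc, Finset.mem_range] at *; omega
  have := (LSeriesSummable_of_sum_norm_bigO_and_nonneg (s := (σ : ℂ)) hO h.nonneg zero_le_one
    (by simpa using hσ)).norm
  refine this.congr fun n => ?_
  rw [LSeries.norm_term_eq]
  split_ifs with hn
  · simp [hn, Real.zero_rpow (show -σ ≠ 0 by linarith)]
  · rw [Complex.norm_real, Real.norm_of_nonneg (h.nonneg n), Complex.ofReal_re,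
      Real.rpow_neg (by positivity), div_eq_mul_inv]

theorem summable_one_add_rpow (h : SelfDualTheta r a) {σ c : ℝ} (hσ : 1 < σ) (hc : 0 < c) :
    Summable fun n : ℕ => r n * (1 + c * n) ^ (-σ) := by
  refine Summable.of_norm_bounded_eventually_nat ((h.summable_rpow hσ).mul_left (c ^ (-σ))) ?_
  filter_upwards [eventually_ge_atTop 1] with n hn
  have hn0 : (0 : ℝ) < n := by exact_mod_cast hn
  have hr := h.nonneg n
  rw [Real.norm_of_nonneg (by positivity), mul_left_comm, ← Real.mul_rpow hc.le hn0.le]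
  gcongr r n * ?_
  exact Real.rpow_le_rpow_of_nonpos (by positivity) (by linarith) (by linarith)

theorem abs_riesz_term_le (h : SelfDualTheta r a) (n : ℕ) {t : ℝ} (ht : 0 ≤ t) :
    |r n * max (t - n) 0| ≤ r n * (1 + 1 * (n : ℝ)) ^ (-2 : ℝ) * (1 + t) ^ 3 := by
  have hr := h.nonneg n
  rw [abs_mul, abs_of_nonneg hr, abs_of_nonneg (le_max_right _ _), mul_assoc, one_mul]
  gcongr
  have hn0 : (0 : ℝ) ≤ n := n.cast_nonneg
  rw [Real.rpow_neg (by positivity), Real.rpow_ofNat, inv_mul_eq_div]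
  rw [le_div_iff₀ (by positivity)]
  rcases le_total t n with hle | hle
  · rw [max_eq_right (by linarith), zero_mul]; positivity
  · calc max (t - n) 0 * (1 + n) ^ 2 ≤ (1 + t) * (1 + t) ^ 2 := by
          gcongr
          exact max_le (by linarith) (by linarith)
      _ = _ := by ring

/-- The uniform bound is used with the roles exchanged: t is the power variable and an the decaying
one. The exponent 5/4 exceeds 1, so the dual series converges absolutely; E_1 would give only 3/4,
which is why the Riesz mean has order one. -/
theorem exists_dual_term_bound (h : SelfDualTheta r a) :
    ∃ C : ℝ, 0 < C ∧ ∀ (n : ℕ) (t : ℝ), 0 ≤ t → |r n * (t ^ 2 * besselE 2 (a * n * t))| ≤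
      C * (r n * (1 + a * (n : ℝ)) ^ (-(5 / 4) : ℝ)) * (1 + t) ^ 2 := by
  obtain ⟨C, hC, hCb⟩ := exists_pow_mul_besselE_bound (ν := 2) (by norm_num)
  refine ⟨C, hC, fun n t ht => ?_⟩
  have hr := h.nonneg n
  have ha := h.pos
  have h1 := hCb t (a * n) ht (by positivity)
  rw [show (-(((2 : ℕ) : ℝ) / 2 + 1 / 4) : ℝ) = -(5 / 4) by norm_num, mul_comm t (a * n)] at h1
  rw [abs_mul, abs_of_nonneg hr]
  calc _ ≤ r n * (C * (1 + t) ^ 2 * (1 + a * n) ^ (-(5 / 4) : ℝ)) := by gcongr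
    _ = _ := by ring

open MeasureTheory Set in
/-- The Riesz mean of order one. -/
theorem riesz_mean_eq (h : SelfDualTheta r a) {t : ℝ} (ht : 0 < t) :
    ∑' n : ℕ, r n * max (t - n) 0 = √a * ∑' n : ℕ, r n * (t ^ 2 * besselE 2 (a * n * t)) := by
  have ha := h.pos
  obtain ⟨C, hC, hCb⟩ := h.exists_dual_term_bound
  have h2 := continuous_besselE 2
  have hu1 := h.summable_one_add_rpow (σ := 2) (c := 1) (by norm_num) one_pos
  have hu2 := (h.summable_one_add_rpow (σ := 5 / 4) (by norm_num) ha).mul_left C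
  have hc1 (n : ℕ) : ContinuousOn (fun t : ℝ => r n * max (t - n) 0) (Ici 0) := by fun_prop
  have hc2 (n : ℕ) : ContinuousOn (fun t : ℝ => r n * (t ^ 2 * besselE 2 (a * n * t))) (Ici 0) := by
    fun_prop
  have hb1 (n : ℕ) (t : ℝ) (ht : 0 ≤ t) := h.abs_riesz_term_le n ht
  have k1 := continuousOn_tsum_of_le_mul_pow hc1 hu1 hb1
  have k2 : ContinuousOn (fun t : ℝ => √a * ∑' n : ℕ, r n * (t ^ 2 * besselE 2 (a * n * t)))
      (Ici 0) := (continuousOn_tsum_of_le_mul_pow hc2 hu2 hCb).const_smul √a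
  have b1 (t : ℝ) (ht : 0 ≤ t) := abs_tsum_le_of_le_mul_pow hu1 hb1 ht
  have b2 (t : ℝ) (ht : 0 ≤ t) := abs_tsum_le_of_le_mul_pow hu2 hCb ht
  set U1 := ∑' n : ℕ, r n * (1 + 1 * (n : ℝ)) ^ (-2 : ℝ)
  set U2 := ∑' n : ℕ, C * (r n * (1 + a * (n : ℝ)) ^ (-(5 / 4) : ℝ)) with hU2
  have hU2' : 0 ≤ U2 := tsum_nonneg fun n => by have := h.nonneg n; positivity
  have b2' (t : ℝ) (ht : 0 ≤ t) :
      |√a * ∑' n : ℕ, r n * (t ^ 2 * besselE 2 (a * n * t))| ≤ √a * U2 * (1 + t) ^ 3 := by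
    rw [abs_mul, abs_of_nonneg (Real.sqrt_nonneg a), mul_assoc]
    gcongr
    refine (b2 t ht).trans ?_
    gcongr
    · linarith
    · norm_num
  refine sub_eq_zero.1 (eq_zero_of_laplace_eq_zero
    (F := fun t => ∑' n : ℕ, r n * max (t - n) 0 -
      √a * ∑' n : ℕ, r n * (t ^ 2 * besselE 2 (a * n * t)))
    (C := U1 + √a * U2) (k := 3) (k1.sub k2) (fun t ht => ?_) (fun s hs => ?_) ht)
  · refine (abs_sub _ _).trans ?_
    rw [add_mul]
    exact add_le_add (b1 t ht) (b2' t ht)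
  -- The two transforms are θ(s)/s² and √a θ(a/s)/s³, equal by the functional equation.
  · simp_rw [mul_sub]
    rw [integral_sub (integrableOn_exp_mul_of_le_pow k1 b1 hs)
      (integrableOn_exp_mul_of_le_pow k2 b2' hs), laplace_tsum hc1 hu1 hb1 hs]
    simp_rw [mul_left_comm _ √a]
    rw [integral_const_mul, laplace_tsum hc2 hu2 hCb hs, sub_eq_zero]
    simp_rw [mul_left_comm (Real.exp _) (r _), integral_const_mul,
      integral_exp_neg_mul_mul_max_sub hs (Nat.cast_nonneg _),
      integral_exp_neg_mul_mul_pow_mul_besselE 2 _ hs, ← mul_div_assoc]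
    rw [tsum_div_const, tsum_div_const, h.feq s hs]
    have : ∀ n : ℕ, (n : ℝ) * (a / s) = a * n / s := fun n => by ring
    simp_rw [this]
    field_simp
    ring

end SelfDualTheta

/-! ### Double summation by parts and error terms -/

/-- Taylor's formula of order two at `N`, with the remainder written over `[0, N]`. -/
theorem taylor_two_max {φ φ' φ'' : ℝ → ℝ} (h1 : ∀ t, HasDerivAt φ (φ' t) t)
    (h2 : ∀ t, HasDerivAt φ' (φ'' t) t) (hc : Continuous φ'') {n N : ℝ} (hn : 0 ≤ n)
    (hnN : n ≤ N) :
    φ n = φ N - (N - n) * φ' N + ∫ t in (0 : ℝ)..N, max (t - n) 0 * φ'' t := by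
  have hc' : Continuous fun t => max (t - n) 0 * φ'' t := by fun_prop
  rw [← intervalIntegral.integral_add_adjacent_intervals (hc'.intervalIntegrable 0 n)
    (hc'.intervalIntegrable n N)]
  have e1 : ∫ t in (0 : ℝ)..n, max (t - n) 0 * φ'' t = 0 := by
    rw [intervalIntegral.integral_congr (g := fun _ => (0 : ℝ)), intervalIntegral.integral_zero]
    intro t ht
    rw [Set.uIcc_of_le hn] at ht
    simp only
    rw [max_eq_right (by linarith [ht.2]), zero_mul]
  have e2 : ∫ t in n..N, max (t - n) 0 * φ'' t = (N - n) * φ' N - φ N + φ n := by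
    rw [intervalIntegral.integral_congr (g := fun t => (t - n) * φ'' t)]
    · rw [intervalIntegral.integral_eq_sub_of_hasDerivAt
        (f := fun t => (t - n) * φ' t - φ t) (fun t _ => ?_)
        (Continuous.intervalIntegrable (by fun_prop) _ _)]
      · ring
      · refine ((((hasDerivAt_id t).sub_const n).mul (h2 t)).sub (h1 t)).congr_deriv ?_
        simp
    · intro t ht
      rw [Set.uIcc_of_le hnN] at ht
      simp only
      rw [max_eq_left (by linarith [ht.1])]
  rw [e1, e2]; ring

namespace SelfDualTheta

variable {r : ℕ → ℝ} {a : ℝ}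

theorem tsum_mul_max_eq_sum_range (r : ℕ → ℝ) {t : ℝ} {N : ℕ} (ht : t ≤ N) :
    ∑' n : ℕ, r n * max (t - n) 0 = ∑ n ∈ Finset.range (N + 1), r n * max (t - n) 0 := by
  refine tsum_eq_sum fun n hn => ?_
  have : (N : ℝ) < n := by
    exact_mod_cast (by simpa [Nat.lt_succ_iff] using hn : N < n)
  rw [max_eq_right (by linarith), mul_zero]

/-- Summing Taylor's formula against r(n) is Abel summation performed twice; both the second
boundary term and the integral involve only the Riesz mean. -/
theorem sum_range_mul_eq {φ φ' φ'' : ℝ → ℝ} (h1 : ∀ t, HasDerivAt φ (φ' t) t)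
    (h2 : ∀ t, HasDerivAt φ' (φ'' t) t) (hc : Continuous φ'') (r : ℕ → ℝ) (N : ℕ) :
    ∑ n ∈ Finset.range (N + 1), r n * φ n =
      (∑ n ∈ Finset.range (N + 1), r n) * φ N -
      (∑' n : ℕ, r n * max ((N : ℝ) - n) 0) * φ' N +
      ∫ t in (0 : ℝ)..N, (∑' n : ℕ, r n * max (t - n) 0) * φ'' t := by
  have hI : ∫ t in (0 : ℝ)..N, (∑' n : ℕ, r n * max (t - n) 0) * φ'' t =
      ∑ n ∈ Finset.range (N + 1), r n * ∫ t in (0 : ℝ)..N, max (t - n) 0 * φ'' t := by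
    simp_rw [← intervalIntegral.integral_const_mul]
    rw [← intervalIntegral.integral_finsetSum
      (fun n _ => Continuous.intervalIntegrable (by fun_prop) _ _)]
    refine intervalIntegral.integral_congr fun t ht => ?_
    rw [Set.uIcc_of_le N.cast_nonneg] at ht
    rw [tsum_mul_max_eq_sum_range r ht.2, Finset.sum_mul]
    exact Finset.sum_congr rfl fun n _ => by ring
  rw [hI, tsum_mul_max_eq_sum_range r le_rfl, Finset.sum_mul, Finset.sum_mul,
    ← Finset.sum_sub_distrib, ← Finset.sum_add_distrib]
  refine Finset.sum_congr rfl fun n hn => ?_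
  have hnN : (n : ℝ) ≤ N := by exact_mod_cast Finset.mem_range_succ_iff.1 hn
  rw [taylor_two_max h1 h2 hc n.cast_nonneg hnN, max_eq_left (by linarith)]
  ring

/-- The Riesz mean of order one with its main term split off. -/
theorem riesz_mean_eq_main_add (h : SelfDualTheta r a) {t : ℝ} (ht : 0 < t) :
    ∑' n : ℕ, r n * max (t - n) 0 = √a * r 0 * (t ^ 2 / 2) +
      √a * ∑' m : ℕ, r (m + 1) * (t ^ 2 * besselE 2 (a * (m + 1 : ℕ) * t)) := by
  obtain ⟨C, hC, hCb⟩ := h.exists_dual_term_bound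
  have hs : Summable fun n : ℕ => r n * (t ^ 2 * besselE 2 (a * n * t)) :=
    Summable.of_norm_bounded
      (((h.summable_one_add_rpow (σ := 5 / 4) (by norm_num) h.pos).mul_left C).mul_right
        ((1 + t) ^ 2)) fun n => hCb n t ht.le
  rw [h.riesz_mean_eq ht, hs.tsum_eq_zero_add, mul_add]
  simp only [Nat.cast_zero, mul_zero, zero_mul, besselE_zero_right, Nat.factorial_two]
  push_cast
  ring

/-- For n ≥ 1 each dual term is O(t² (nt)^(-5/4)), and ∑ r(n) n^(-5/4) converges. -/
theorem exists_riesz_error_bound (h : SelfDualTheta r a) :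
    ∃ C : ℝ, 0 ≤ C ∧ ∀ t : ℝ, 0 < t →
      |∑' n : ℕ, r n * max (t - n) 0 - √a * r 0 * (t ^ 2 / 2)| ≤ C * t ^ (3 / 4 : ℝ) := by
  obtain ⟨C, hC, hCb⟩ := exists_besselE_mul_bound 2
  have ha := h.pos
  rw [show (-(((2 : ℕ) : ℝ) / 2 + 1 / 4) : ℝ) = -(5 / 4) by norm_num] at hCb
  have hs := (summable_nat_add_iff 1).2 (h.summable_rpow (σ := 5 / 4) (by norm_num))
  set U := ∑' m : ℕ, r (m + 1) * ((m + 1 : ℕ) : ℝ) ^ (-(5 / 4) : ℝ) with hU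
  have hU0 : 0 ≤ U := tsum_nonneg fun m => by have := h.nonneg (m + 1); positivity
  refine ⟨√a * (C * a ^ (-(5 / 4) : ℝ) * U), by positivity, fun t ht => ?_⟩
  rw [h.riesz_mean_eq_main_add ht, add_sub_cancel_left, abs_mul, abs_of_nonneg (Real.sqrt_nonneg a),
    mul_assoc]
  gcongr √a * ?_
  rw [← Real.norm_eq_abs, show C * a ^ (-(5 / 4) : ℝ) * U * t ^ (3 / 4 : ℝ) =
    U * (C * a ^ (-(5 / 4) : ℝ) * t ^ (3 / 4 : ℝ)) by ring]
  refine tsum_of_norm_bounded (hs.hasSum.mul_right _) fun m => ?_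
  have hr := h.nonneg (m + 1)
  have hm : (0 : ℝ) < (m + 1 : ℕ) := by positivity
  have h1 := hCb (a * (m + 1 : ℕ)) t (by positivity) ht
  rw [Real.norm_eq_abs, abs_mul, abs_of_nonneg hr, abs_mul, abs_of_pos (by positivity : 0 < t ^ 2)]
  have e : t ^ (3 / 4 : ℝ) = t ^ (2 : ℕ) * t ^ (-(5 / 4) : ℝ) := by
    rw [← Real.rpow_natCast, ← Real.rpow_add ht]; norm_num
  calc _ ≤ r (m + 1) * (t ^ 2 * (C * (a * (m + 1 : ℕ)) ^ (-(5 / 4) : ℝ) *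
        t ^ (-(5 / 4) : ℝ))) := by gcongr
    _ = _ := by rw [e, Real.mul_rpow ha.le hm.le]; ring

/-- Since r ≥ 0, the partial sum up to N lies between difference quotients of the Riesz mean with
steps -q and q. A crude error O(N) for that mean with q = √N already gives O(N^(1/2)); any exponent
below 3/4 would serve, φ(N) being O(N^(-3/4)). -/
theorem exists_sum_error_bound (h : SelfDualTheta r a) :
    ∃ C : ℝ, 0 ≤ C ∧ ∀ N : ℕ, 1 ≤ N →
      |∑ n ∈ Finset.range (N + 1), r n - √a * r 0 * N| ≤ C * (N : ℝ) ^ (1 / 2 : ℝ) := by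
  obtain ⟨C, hC, hCb⟩ := h.exists_riesz_error_bound
  set Δ := √a * r 0 with hΔ
  have hΔ0 : 0 ≤ Δ := mul_nonneg (Real.sqrt_nonneg a) (h.nonneg 0)
  set L : ℝ → ℝ := fun t => ∑' n : ℕ, r n * max (t - n) 0 with hL
  refine ⟨Δ / 2 + 3 * C, by positivity, fun N hN => ?_⟩
  have hN1 : (1 : ℝ) ≤ N := by exact_mod_cast hN
  have hN0 : (0 : ℝ) < N := by linarith
  set R := ∑ n ∈ Finset.range (N + 1), r n with hR
  set q := (N : ℝ) ^ (1 / 2 : ℝ) with hq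
  have hq1 : 1 ≤ q := Real.one_le_rpow hN1 (by norm_num)
  have hqq : q * q = N := by
    rw [hq, ← Real.rpow_add hN0]; norm_num
  have hqN : q ≤ N := by nlinarith
  have hL0 : L 0 = 0 := by
    simp [hL]
  have hCb' (t : ℝ) (ht : 0 ≤ t) : |L t - Δ * (t ^ 2 / 2)| ≤ C * t ^ (3 / 4 : ℝ) := by
    rcases ht.eq_or_lt with rfl | ht
    · rw [hL0]; simp
    · exact hCb t ht
  have hpow (t : ℝ) (ht : 0 ≤ t) (htN : t ≤ 2 * N) : t ^ (3 / 4 : ℝ) ≤ 2 * N := by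
    calc t ^ (3 / 4 : ℝ) ≤ (2 * N : ℝ) ^ (3 / 4 : ℝ) := by gcongr
      _ ≤ (2 * N : ℝ) ^ (1 : ℝ) :=
        Real.rpow_le_rpow_of_exponent_le (by linarith) (by norm_num)
      _ = 2 * N := Real.rpow_one _
  have hpow' (t : ℝ) (ht : 0 ≤ t) (htN : t ≤ N) : t ^ (3 / 4 : ℝ) ≤ N := by
    calc t ^ (3 / 4 : ℝ) ≤ (N : ℝ) ^ (3 / 4 : ℝ) := by gcongr
      _ ≤ (N : ℝ) ^ (1 : ℝ) := Real.rpow_le_rpow_of_exponent_le hN1 (by norm_num)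
      _ = N := Real.rpow_one _
  have hLN : L N = ∑ n ∈ Finset.range (N + 1), r n * (N - n) := by
    simp only [hL]
    rw [tsum_mul_max_eq_sum_range r le_rfl]
    refine Finset.sum_congr rfl fun n hn => ?_
    have hnN : (n : ℝ) ≤ N := by exact_mod_cast Finset.mem_range_succ_iff.1 hn
    rw [max_eq_left (by linarith)]
  have hup : q * R + L N ≤ L (N + q) := by
    have e : L (N + q) = ∑ n ∈ Finset.range (2 * N + 1), r n * max ((N : ℝ) + q - n) 0 :=
      tsum_mul_max_eq_sum_range r (by push_cast; linarith)
    rw [hLN, hR, Finset.mul_sum, ← Finset.sum_add_distrib, e]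
    refine le_trans (Finset.sum_le_sum fun n _ => ?_) (Finset.sum_le_sum_of_subset_of_nonneg
      (Finset.range_mono (by omega)) fun n _ _ => mul_nonneg (h.nonneg n) (le_max_right _ _))
    have h1 := mul_le_mul_of_nonneg_left (le_max_left ((N : ℝ) + q - n) 0) (h.nonneg n)
    linarith
  have hlow : L N ≤ q * R + L (N - q) := by
    have e : L (N - q) = ∑ n ∈ Finset.range (N + 1), r n * max ((N : ℝ) - q - n) 0 :=
      tsum_mul_max_eq_sum_range r (by linarith)
    rw [hLN, hR, Finset.mul_sum, e, ← Finset.sum_add_distrib]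
    refine Finset.sum_le_sum fun n _ => ?_
    have h1 := mul_le_mul_of_nonneg_left (le_max_left ((N : ℝ) - q - n) 0) (h.nonneg n)
    linarith
  have b0 := abs_le.1 (hCb' N hN0.le)
  have b1 := abs_le.1 (hCb' (N + q) (by positivity))
  have b2 := abs_le.1 (hCb' (N - q) (by linarith))
  have c0 := mul_le_mul_of_nonneg_left (hpow' N hN0.le le_rfl) hC
  have c1 := mul_le_mul_of_nonneg_left (hpow (N + q) (by positivity) (by linarith)) hC
  have c2 := mul_le_mul_of_nonneg_left (hpow' (N - q) (by linarith) (by linarith)) hC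
  have hq0 : 0 < q := by linarith
  have d1 : q * (R - Δ * N) ≤ q * ((Δ / 2 + 3 * C) * q) := by
    have e1 : q * ((Δ / 2 + 3 * C) * q) = (Δ / 2 + 3 * C) * (q * q) := by ring
    have e2 : Δ * (((N : ℝ) + q) ^ 2 / 2) =
      Δ * ((N : ℝ) ^ 2 / 2) + q * (Δ * N) + Δ / 2 * (q * q) := by ring
    rw [e1]
    rw [e2] at b1
    rw [hqq] at *
    linarith
  have d2 : q * (Δ * N - R) ≤ q * ((Δ / 2 + 3 * C) * q) := by
    have e1 : q * ((Δ / 2 + 3 * C) * q) = (Δ / 2 + 3 * C) * (q * q) := by ring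
    have e2 : Δ * (((N : ℝ) - q) ^ 2 / 2) =
      Δ * ((N : ℝ) ^ 2 / 2) - q * (Δ * N) + Δ / 2 * (q * q) := by ring
    rw [e1]
    rw [e2] at b2
    rw [hqq] at *
    have : 0 ≤ C * N := by positivity
    linarith
  rw [abs_le]
  constructor
  · linarith [le_of_mul_le_mul_left d2 hq0]
  · exact le_of_mul_le_mul_left d1 hq0

end SelfDualTheta

/-! ### Hardy's identity -/

/-- This is the contribution of n = 0. Its E_1 and E_2 terms are what cancels the main parts of the
boundary terms, and its constant 1 becomes the summand r(0) of the limit. -/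
theorem discontIntegral_zero (c T : ℝ) :
    discontIntegral 0 c T = 1 - besselE 0 (c * T) - c * T * besselE 1 (c * T) -
      (c * T) ^ 2 * besselE 2 (c * T) / 2 := by
  have h3 := continuous_besselE 3
  have hd (t : ℝ) : HasDerivAt (fun t => -besselE 0 (c * t) - c * t * besselE 1 (c * t) -
      (c * t) ^ 2 * besselE 2 (c * t) / 2)
      (t ^ 2 * besselE 2 (0 * t) * (c ^ 3 * besselE 3 (c * t))) t := by
    have h0 := hasDerivAt_besselE_mul 0 c t
    have h1 := hasDerivAt_besselE_mul 1 c t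
    have h2 := hasDerivAt_besselE_mul 2 c t
    have ht := (hasDerivAt_id t).const_mul c
    refine ((h0.neg.sub (ht.mul h1)).sub (((ht.pow 2).mul h2).div_const 2)).congr_deriv ?_
    rw [zero_mul, besselE_zero_right]
    norm_num
    ring
  rw [discontIntegral, intervalIntegral.integral_eq_sub_of_hasDerivAt (fun t _ => hd t)
    (Continuous.intervalIntegrable (by
      simp only [zero_mul]; fun_prop) _ _)]
  simp [besselE_zero_right]
  ring

namespace SelfDualTheta

variable {r : ℕ → ℝ} {a : ℝ}

/-- On the bounded interval [0, N] the expansion of the Riesz mean is dominated by a convergent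
series of constants, so it may be integrated termwise against φ''. -/
theorem hasSum_integral_riesz_mul (h : SelfDualTheta r a) (x : ℝ) (N : ℕ) :
    HasSum (fun n : ℕ => r n * discontIntegral (a * n) (a * x) N)
      (∫ t in (0 : ℝ)..N, (∑' n : ℕ, r n * max (t - n) 0) *
        (√a * x * (a * x * (a * x * besselE 3 (a * x * t))))) := by
  obtain ⟨C, hC, hCb⟩ := h.exists_dual_term_bound
  have ha := h.pos
  have h2 := continuous_besselE 2
  have h3 := continuous_besselE 3
  have hu := (h.summable_one_add_rpow (σ := 5 / 4) (by norm_num) ha).mul_left C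
  set ψ : ℝ → ℝ := fun t => √a * x * (a * x * (a * x * besselE 3 (a * x * t))) with hψ
  have hψc : Continuous ψ := by fun_prop
  obtain ⟨B, hB⟩ := (isCompact_Icc (a := (0 : ℝ)) (b := N)).exists_bound_of_continuousOn
    hψc.continuousOn
  have hB0 : 0 ≤ B := (norm_nonneg _).trans (hB 0 ⟨le_rfl, N.cast_nonneg⟩)
  have hterm (n : ℕ) : r n * discontIntegral (a * n) (a * x) N =
      ∫ t in (0 : ℝ)..N, √a * (r n * (t ^ 2 * besselE 2 (a * n * t))) * ψ t := by
    rw [discontIntegral, ← intervalIntegral.integral_const_mul]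
    congr 1
    ext t
    simp only [hψ]
    have := Real.mul_self_sqrt ha.le
    linear_combination (-(r n * t ^ 2 * besselE 2 (a * n * t) * x * (a * x) ^ 2 *
      besselE 3 (a * x * t))) * this
  simp_rw [hterm]
  refine intervalIntegral.hasSum_integral_of_dominated_convergence
    (fun n _ => √a * (C * (r n * (1 + a * (n : ℝ)) ^ (-(5 / 4) : ℝ)) * (1 + N) ^ 2) * B)
    (fun n => Continuous.aestronglyMeasurable (by fun_prop)) (fun n => ?_) ?_ (by simp) ?_
  · refine Eventually.of_forall fun t ht => ?_
    rw [Set.uIoc_of_le N.cast_nonneg] at ht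
    rw [norm_mul, norm_mul, Real.norm_of_nonneg (Real.sqrt_nonneg a), Real.norm_eq_abs (r n * _)]
    have hr := h.nonneg n
    have ht0 := ht.1
    gcongr
    · refine (hCb n t ht.1.le).trans ?_
      gcongr
      exact ht.2
    · exact hB t ⟨ht.1.le, ht.2⟩
  · exact Eventually.of_forall fun t _ => ((hu.mul_right _).mul_left _).mul_right _
  · refine Eventually.of_forall fun t ht => ?_
    rw [Set.uIoc_of_le N.cast_nonneg] at ht
    refine HasSum.mul_right _ ?_
    rw [h.riesz_mean_eq ht.1]
    refine HasSum.mul_left _ (Summable.hasSum ?_)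
    exact Summable.of_norm_bounded (hu.mul_right _) fun n => hCb n t ht.1.le

/-- Dominated convergence over n. The majorant degenerates at an index with n = x, where the
boundedness of a convergent sequence (the constant D) replaces it. -/
theorem tendsto_tsum_discontIntegral (h : SelfDualTheta r a) {x : ℝ} (hx : 0 < x) :
    Tendsto (fun N : ℕ => ∑' m : ℕ, r (m + 1) * discontIntegral (a * (m + 1 : ℕ)) (a * x) N) atTop
      (𝓝 (∑ n ∈ Finset.Icc 1 ⌊x⌋₊, (if (n : ℝ) = x then 1 / 2 else 1) * r n)) := by
  have ha := h.pos
  have hc : 0 < a * x := by positivity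
  set g : ℕ → ℝ := fun n => if (n : ℝ) = x then 1 / 2 else if (n : ℝ) < x then 1 else 0 with hg
  have hlim (m : ℕ) : Tendsto (fun N : ℕ => r (m + 1) *
      discontIntegral (a * (m + 1 : ℕ)) (a * x) N) atTop (𝓝 (r (m + 1) * g (m + 1))) := by
    refine Tendsto.const_mul _ ?_
    by_cases hm : ((m + 1 : ℕ) : ℝ) = x
    · simp only [hg, if_pos hm]
      rw [hm]
      exact (tendsto_discontIntegral_self hc).comp tendsto_natCast_atTop_atTop
    · simp only [hg, if_neg hm]
      have := tendsto_discontIntegral_of_ne (b := a * (m + 1 : ℕ)) (c := a * x) (by positivity) hc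
        (by simpa [ha.ne'] using hm)
      simp only [mul_lt_mul_iff_right₀ ha] at this
      exact this.comp tendsto_natCast_atTop_atTop
  obtain ⟨C, hC, hCb⟩ := exists_discontIntegral_bound hc
  obtain ⟨D, hD⟩ := ((tendsto_discontIntegral_self hc).comp
    tendsto_natCast_atTop_atTop).abs.bddAbove_range
  set u : ℕ → ℝ := fun m => r (m + 1) * (if a * (m + 1 : ℕ) = a * x then D else
    C * ((a * (m + 1 : ℕ)) ^ (-(3 / 4) : ℝ) + (a * (m + 1 : ℕ)) ^ (-(5 / 4) : ℝ)) /
      |a * (m + 1 : ℕ) - a * x|) with hu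
  have hus : Summable u := by
    have hs := ((summable_nat_add_iff 1).2 (h.summable_rpow (σ := 7 / 4) (by norm_num))).mul_left
      (4 * C * a ^ (-(7 / 4) : ℝ))
    refine Summable.of_norm_bounded_eventually_nat hs ?_
    have htop : Tendsto (fun m : ℕ => a * ((m + 1 : ℕ) : ℝ)) atTop atTop :=
      (tendsto_natCast_atTop_atTop.comp (tendsto_add_atTop_nat 1)).const_mul_atTop ha
    -- For b = an > 2ax one has |b - ax| ≥ b/2, and for b ≥ 1 the power b^(-3/4) dominates b^(-5/4);
    -- together these give the constant 4.
    filter_upwards [htop.eventually_ge_atTop 1, htop.eventually_gt_atTop (2 * (a * x))]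
      with m hm1 hm2
    set b := a * ((m + 1 : ℕ) : ℝ) with hb
    have hb0 : 0 < b := by linarith
    have hr := h.nonneg (m + 1)
    have hne : b ≠ a * x := by
      intro he; linarith
    simp only [hu]
    rw [← hb, if_neg hne, abs_of_pos (by linarith), Real.norm_of_nonneg (by
      have : 0 < b - a * x := by linarith
      positivity), mul_left_comm]
    gcongr r (m + 1) * ?_
    have e : (4 * C * a ^ (-(7 / 4) : ℝ)) * ((m + 1 : ℕ) : ℝ) ^ (-(7 / 4) : ℝ) =
        4 * C * b ^ (-(7 / 4) : ℝ) := by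
      rw [hb, Real.mul_rpow ha.le (by positivity)]; ring
    rw [e, div_le_iff₀ (by linarith)]
    have e1 : b ^ (-(7 / 4) : ℝ) * b = b ^ (-(3 / 4) : ℝ) := by
      rw [← Real.rpow_add_one hb0.ne']; norm_num
    have e2 : b ^ (-(5 / 4) : ℝ) ≤ b ^ (-(3 / 4) : ℝ) :=
      Real.rpow_le_rpow_of_exponent_le hm1 (by norm_num)
    calc C * (b ^ (-(3 / 4) : ℝ) + b ^ (-(5 / 4) : ℝ)) ≤ C * (2 * b ^ (-(3 / 4) : ℝ)) := by
          gcongr; linarith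
      _ = 4 * C * b ^ (-(7 / 4) : ℝ) * (b / 2) := by rw [← e1]; ring
      _ ≤ _ := by gcongr; linarith
  have hmain := tendsto_tsum_of_dominated_convergence (𝓕 := atTop) hus hlim (by
    filter_upwards [eventually_ge_atTop 1] with N hN m
    have hr := h.nonneg (m + 1)
    rw [norm_mul, Real.norm_of_nonneg hr, Real.norm_eq_abs]
    simp only [hu]
    gcongr
    split_ifs with hm
    · rw [hm]; exact hD ⟨N, rfl⟩
    · exact hCb _ _ (by positivity) hm (by exact_mod_cast hN))
  convert hmain using 2
  rw [tsum_eq_sum (s := Finset.range ⌊x⌋₊)]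
  · refine Finset.sum_nbij' (· - 1) (· + 1) (fun n hn => ?_) (fun n hn => ?_) (fun n hn => ?_)
      (fun n hn => ?_) (fun n hn => ?_)
    all_goals simp only [Finset.mem_Icc, Finset.mem_range] at *
    any_goals omega
    have hnx : (n : ℝ) ≤ x := (Nat.le_floor_iff hx.le).1 hn.2
    rw [Nat.sub_add_cancel hn.1, mul_comm]
    simp only [hg]
    split_ifs with h1 h2
    · rfl
    · rfl
    · exact absurd (lt_of_le_of_ne hnx h1) h2
  · intro m hm
    have hlt : x < ((m + 1 : ℕ) : ℝ) := by
      rw [Finset.mem_range, not_lt] at hm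
      exact (Nat.floor_lt hx.le).1 (by omega)
    simp only [hg]
    rw [if_neg hlt.ne', if_neg hlt.le.not_gt, mul_zero]

/-- Hardy's identity. -/
theorem tendsto_sum_range_besselE (h : SelfDualTheta r a) {x : ℝ} (hx : 0 < x) :
    Tendsto (fun N : ℕ => ∑ n ∈ Finset.range (N + 1), r n * (√a * x * besselE 1 (a * x * n))) atTop
      (𝓝 (r 0 + ∑ n ∈ Finset.Icc 1 ⌊x⌋₊, (if (n : ℝ) = x then 1 / 2 else 1) * r n)) := by
  have ha := h.pos
  set c := a * x with hcdef
  have hc : 0 < c := by positivity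
  have h3 := continuous_besselE 3
  have hsa : √a * √a = a := Real.mul_self_sqrt ha.le
  set φ : ℝ → ℝ := fun t => √a * x * besselE 1 (c * t) with hφ
  set φ' : ℝ → ℝ := fun t => √a * x * -(c * besselE 2 (c * t)) with hφ'
  set φ'' : ℝ → ℝ := fun t => √a * x * (c * (c * besselE 3 (c * t))) with hφ''
  have hd1 (t : ℝ) : HasDerivAt φ (φ' t) t := (hasDerivAt_besselE_mul 1 c t).const_mul _
  have hd2 (t : ℝ) : HasDerivAt φ' (φ'' t) t := by
    refine (((hasDerivAt_besselE_mul 2 c t).const_mul c).neg.const_mul (√a * x)).congr_deriv ?_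
    simp only [hφ'']; ring
  set R : ℕ → ℝ := fun N => ∑ n ∈ Finset.range (N + 1), r n with hR
  set L : ℝ → ℝ := fun t => ∑' n : ℕ, r n * max (t - n) 0 with hL
  set Δ := √a * r 0 with hΔ
  -- Subtracting ΔN and ΔN²/2 from the two partial sums is compensated by the n = 0 integral,
  -- because √a √a = a.
  have key (N : ℕ) : ∑ n ∈ Finset.range (N + 1), r n * φ n =
      (R N - Δ * N) * φ N - (L N - Δ * ((N : ℝ) ^ 2 / 2)) * φ' N + r 0 * (1 - besselE 0 (c * N)) +
      ∑' m : ℕ, r (m + 1) * discontIntegral (a * (m + 1 : ℕ)) c N := by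
    have hs := h.hasSum_integral_riesz_mul x N
    have e := hs.tsum_eq
    rw [hs.summable.tsum_eq_zero_add] at e
    rw [sum_range_mul_eq hd1 hd2 (by fun_prop) r N, ← hcdef] at *
    rw [← e, Nat.cast_zero, mul_zero, discontIntegral_zero]
    simp only [hφ, hφ', hΔ, hR, hL]
    rw [hcdef]
    linear_combination (r 0 * N * x * besselE 1 (a * x * N) +
      r 0 * (N : ℝ) ^ 2 / 2 * x * (a * x) * besselE 2 (a * x * N)) * hsa
  obtain ⟨C1, hC1, hb1⟩ := h.exists_sum_error_bound
  obtain ⟨C2, hC2, hb2⟩ := h.exists_riesz_error_bound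
  obtain ⟨B0, hB0, hE0⟩ := exists_besselE_mul_bound 0
  obtain ⟨B1, hB1, hE1⟩ := exists_besselE_mul_bound 1
  obtain ⟨B2, hB2, hE2⟩ := exists_besselE_mul_bound 2
  rw [show (-(((0 : ℕ) : ℝ) / 2 + 1 / 4) : ℝ) = -(1 / 4) by norm_num] at hE0
  rw [show (-(((1 : ℕ) : ℝ) / 2 + 1 / 4) : ℝ) = -(3 / 4) by norm_num] at hE1
  rw [show (-(((2 : ℕ) : ℝ) / 2 + 1 / 4) : ℝ) = -(5 / 4) by norm_num] at hE2
  have hzero (p K : ℝ) (hp : 0 < p) : Tendsto (fun N : ℕ => K * (N : ℝ) ^ (-p)) atTop (𝓝 0) := by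
    rw [← mul_zero K]
    exact ((tendsto_rpow_neg_atTop hp).comp tendsto_natCast_atTop_atTop).const_mul K
  have t0 : Tendsto (fun N : ℕ => besselE 0 (c * N)) atTop (𝓝 0) := by
    refine squeeze_zero_norm' ?_ (hzero (1 / 4) (B0 * c ^ (-(1 / 4) : ℝ)) (by norm_num))
    filter_upwards [eventually_ge_atTop 1] with N hN
    exact hE0 c N hc (by exact_mod_cast hN)
  have t1 : Tendsto (fun N : ℕ => (R N - Δ * N) * φ N) atTop (𝓝 0) := by
    refine squeeze_zero_norm' ?_ (hzero (1 / 4) (C1 * (√a * x * (B1 * c ^ (-(3 / 4) : ℝ))))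
      (by norm_num))
    filter_upwards [eventually_ge_atTop 1] with N hN
    have hN0 : (0 : ℝ) < N := by exact_mod_cast hN
    have e : (N : ℝ) ^ (-(1 / 4) : ℝ) = (N : ℝ) ^ (1 / 2 : ℝ) * (N : ℝ) ^ (-(3 / 4) : ℝ) := by
      rw [← Real.rpow_add hN0]; norm_num
    simp only [hφ]
    rw [norm_mul, norm_mul, Real.norm_of_nonneg (by positivity : 0 ≤ √a * x), Real.norm_eq_abs,
      Real.norm_eq_abs, e]
    calc _ ≤ (C1 * (N : ℝ) ^ (1 / 2 : ℝ)) *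
          (√a * x * (B1 * c ^ (-(3 / 4) : ℝ) * (N : ℝ) ^ (-(3 / 4) : ℝ))) := by
          gcongr
          · exact hb1 N hN
          · exact hE1 c N hc hN0
      _ = _ := by ring
  have t2 : Tendsto (fun N : ℕ => (L N - Δ * ((N : ℝ) ^ 2 / 2)) * φ' N) atTop (𝓝 0) := by
    refine squeeze_zero_norm' ?_ (hzero (1 / 2) (C2 * (√a * x * (c * (B2 * c ^ (-(5 / 4) : ℝ)))))
      (by norm_num))
    filter_upwards [eventually_ge_atTop 1] with N hN
    have hN0 : (0 : ℝ) < N := by exact_mod_cast hN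
    have e : (N : ℝ) ^ (-(1 / 2) : ℝ) = (N : ℝ) ^ (3 / 4 : ℝ) * (N : ℝ) ^ (-(5 / 4) : ℝ) := by
      rw [← Real.rpow_add hN0]; norm_num
    simp only [hφ']
    rw [norm_mul, norm_mul (√a * x), norm_neg, norm_mul c, Real.norm_of_nonneg (by positivity : 0 ≤ √a * x),
      Real.norm_of_nonneg hc.le, Real.norm_eq_abs, Real.norm_eq_abs, e]
    calc _ ≤ (C2 * (N : ℝ) ^ (3 / 4 : ℝ)) *
          (√a * x * (c * (B2 * c ^ (-(5 / 4) : ℝ) * (N : ℝ) ^ (-(5 / 4) : ℝ)))) := by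
          gcongr
          · exact hb2 N hN0
          · exact hE2 c N hc hN0
      _ = _ := by ring
  have hlim := ((t1.sub t2).add ((t0.const_sub 1).const_mul (r 0))).add
    (h.tendsto_tsum_discontIntegral hx)
  simp only [sub_zero, mul_one, zero_add] at hlim
  exact hlim.congr fun N => (key N).symm

end SelfDualTheta

/-! ### Analytic continuation of the Dirichlet series -/

namespace SelfDualTheta

variable {r : ℕ → ℝ} {a : ℝ}

theorem continuousOn_theta (h : SelfDualTheta r a) :
    ContinuousOn (fun s : ℝ => ∑' n : ℕ, r n * Real.exp (-(n * s))) (Set.Ioi 0) := by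
  intro s hs
  have hs0 : 0 < s := hs
  have hc : ContinuousOn (fun s : ℝ => ∑' n : ℕ, r n * Real.exp (-(n * s))) (Set.Ici (s / 2)) := by
    refine continuousOn_tsum (fun n => by fun_prop) (h.summable (s / 2) (by positivity))
      fun n t ht => ?_
    have ht' : s / 2 ≤ t := ht
    have hr := h.nonneg n
    rw [Real.norm_of_nonneg (by positivity)]
    gcongr
  exact (hc.continuousAt (Ici_mem_nhds (by linarith))).continuousWithinAt

/-- For t ≥ 1 and n ≥ 1 one has n t ≥ n + t - 1, so a factor e^(-√a t) comes out of the whole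
series. -/
theorem theta_sub_isBigO (h : SelfDualTheta r a) (ρ : ℝ) :
    (fun t : ℝ => ∑' n : ℕ, r n * Real.exp (-(n * (√a * t))) - r 0) =O[atTop] (· ^ ρ) := by
  have ha : 0 < √a := Real.sqrt_pos.2 h.pos
  have hs := (summable_nat_add_iff 1).2 (h.summable √a ha)
  refine (Asymptotics.IsBigO.of_bound (Real.exp √a * ∑' n : ℕ, r (n + 1) *
    Real.exp (-((n + 1 : ℕ) * √a))) ?_).trans (isLittleO_exp_neg_mul_rpow_atTop ha ρ).isBigO
  filter_upwards [eventually_ge_atTop 1] with t ht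
  have ht0 : 0 < √a * t := by positivity
  rw [(h.summable _ ht0).tsum_eq_zero_add]
  simp only [Nat.cast_zero, zero_mul, neg_zero, Real.exp_zero, mul_one, add_sub_cancel_left]
  rw [Real.norm_of_nonneg (Real.exp_pos (-√a * t)).le]
  rw [mul_right_comm, ← Real.exp_add]
  refine tsum_of_norm_bounded (hs.hasSum.mul_left _) fun n => ?_
  have hr := h.nonneg (n + 1)
  rw [Real.norm_of_nonneg (by positivity), mul_left_comm (Real.exp (√a + _)), ← Real.exp_add]
  gcongr
  push_cast
  have : 0 ≤ (n : ℝ) * √a * (t - 1) := by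
    have : 0 ≤ t - 1 := by linarith
    positivity
  nlinarith

/-- The pair of functional-equation data for the theta series. -/
def feq_pair (h : SelfDualTheta r a) : WeakFEPair ℂ where
  f t := ((∑' n : ℕ, r n * Real.exp (-(n * (√a * t))) : ℝ) : ℂ)
  g t := ((∑' n : ℕ, r n * Real.exp (-(n * (√a * t))) : ℝ) : ℂ)
  k := 1
  ε := 1
  f₀ := (r 0 : ℂ)
  g₀ := (r 0 : ℂ)
  hf_int := by
    refine ContinuousOn.locallyIntegrableOn ?_ measurableSet_Ioi
    refine Complex.continuous_ofReal.comp_continuousOn (h.continuousOn_theta.comp (by fun_prop) ?_)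
    intro t ht
    exact mul_pos (Real.sqrt_pos.2 h.pos) ht
  hg_int := by
    refine ContinuousOn.locallyIntegrableOn ?_ measurableSet_Ioi
    refine Complex.continuous_ofReal.comp_continuousOn (h.continuousOn_theta.comp (by fun_prop) ?_)
    intro t ht
    exact mul_pos (Real.sqrt_pos.2 h.pos) ht
  hk := one_pos
  hε := one_ne_zero
  h_feq t ht := by
    have ht0 : 0 < t := ht
    have ha := Real.sqrt_pos.2 h.pos
    -- The rescaling by √a moves the fixed point of s ↦ a/s to 1, which makes the functional
    -- equation one of weight 1 and sign 1.
    have e : a / (√a * (1 / t)) = √a * t := by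
      nth_rewrite 1 [← Real.mul_self_sqrt h.pos.le]
      field_simp
    rw [h.feq _ (by positivity), e, Real.rpow_one, one_mul, smul_eq_mul, ← Complex.ofReal_mul]
    congr 2
    field_simp
  hf_top ρ := by
    have := h.theta_sub_isBigO ρ
    refine (Asymptotics.isBigO_norm_left.1 ?_)
    refine (this.norm_left).congr_left fun t => ?_
    rw [← Complex.ofReal_sub, Complex.norm_real]
  hg_top ρ := by
    have := h.theta_sub_isBigO ρ
    refine (Asymptotics.isBigO_norm_left.1 ?_)
    refine (this.norm_left).congr_left fun t => ?_
    rw [← Complex.ofReal_sub, Complex.norm_real]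

theorem completed_eq (h : SelfDualTheta r a) {s : ℂ} (hs : 1 < s.re) :
    h.feq_pair.Λ s = Complex.Gamma s * ((√a : ℝ) : ℂ) ^ (-s) * LSeries (fun n => (r n : ℂ)) s := by
  have ha := Real.sqrt_pos.2 h.pos
  have hs0 : 0 < s.re := by linarith
  have hm := (h.feq_pair.hasMellin (s := s) hs).2
  have hsum : Summable fun n : ℕ => ‖((if n = 0 then 0 else r n : ℝ) : ℂ)‖ / (√a * n) ^ s.re := by
    refine ((h.summable_rpow hs).mul_left (√a ^ (-s.re))).congr fun n => ?_
    rcases Nat.eq_zero_or_pos n with rfl | hn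
    · simp [Real.zero_rpow (show -s.re ≠ 0 by linarith)]
    · rw [if_neg hn.ne', Complex.norm_real, Real.norm_of_nonneg (h.nonneg n),
        Real.mul_rpow ha.le n.cast_nonneg, Real.rpow_neg ha.le, Real.rpow_neg n.cast_nonneg]
      field_simp
  have hS := hasSum_mellin (a := fun n : ℕ => ((if n = 0 then 0 else r n : ℝ) : ℂ))
    (p := fun n : ℕ => √a * n) (s := s)
    (F := fun t => h.feq_pair.f t - h.feq_pair.f₀) (fun n => ?_) hs0 (fun t ht => ?_) hsum
  · rw [hm] at hS
    rw [← hS.tsum_eq, LSeries, ← tsum_mul_left]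
    refine tsum_congr fun n => ?_
    rw [LSeries.term]
    split_ifs with hn
    · simp
    · push_cast
      rw [← Complex.ofReal_natCast n, Complex.mul_cpow_ofReal_nonneg ha.le n.cast_nonneg,
        Complex.cpow_neg]
      field_simp
  · rcases Nat.eq_zero_or_pos n with rfl | hn
    · left; simp
    · right; positivity
  · have ht0 : 0 < √a * t := mul_pos ha ht
    have h1 := (h.summable _ ht0)
    have h2 : HasSum (fun n : ℕ => (if n = 0 then 0 else r n) * Real.exp (-(√a * n) * t))
        (∑' n : ℕ, r n * Real.exp (-(n * (√a * t))) - r 0) := by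
      have h3 := h1.hasSum.update 0 0
      simp only [Nat.cast_zero, zero_mul, neg_zero, Real.exp_zero, mul_one, zero_sub] at h3
      rw [sub_eq_neg_add]
      refine (congrArg (HasSum · _) ?_).mpr h3
      ext n
      rcases eq_or_ne n 0 with rfl | hn
      · simp
      · rw [Function.update_of_ne hn, if_neg hn]
        ring_nf
    have h4 := Complex.hasSum_ofReal.2 h2
    convert h4 using 1
    · ext n; push_cast; rfl
    · simp [feq_pair]

/-- The Dirichlet series continues to `ℂ ∖ {1}`, with a simple pole at `1`. -/
theorem exists_continuation (h : SelfDualTheta r a) :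
    ∃ Z : ℂ → ℂ, DifferentiableOn ℂ Z {1}ᶜ ∧
      (∀ s : ℂ, 1 < s.re → Z s = LSeries (fun n => (r n : ℂ)) s) ∧
      Tendsto (fun s : ℂ => (s - 1) * Z s) (𝓝[≠] 1) (𝓝 ((√a * r 0 : ℝ) : ℂ)) ∧
      Z 0 = -(r 0 : ℂ) := by
  have ha := Real.sqrt_pos.2 h.pos
  have ha' : ((√a : ℝ) : ℂ) ≠ 0 := Complex.ofReal_ne_zero.2 ha.ne'
  have hG := Complex.differentiable_one_div_Gamma
  have hG1 : Differentiable ℂ fun s : ℂ => (Complex.Gamma (s + 1))⁻¹ :=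
    hG.comp (differentiable_id.add_const 1)
  have hL := h.feq_pair.differentiable_Λ₀
  have hP : Differentiable ℂ fun s : ℂ => ((√a : ℝ) : ℂ) ^ s := fun s =>
    (differentiableAt_id).const_cpow (Or.inl ha')
  -- This is √a^s Λ(s)/Γ(s), with the pole of Λ at 0 already absorbed through 1/(s Γ(s)) = 1/Γ(s+1).
  -- At s = 0 only this last term survives, with value -r(0).
  refine ⟨fun s => ((√a : ℝ) : ℂ) ^ s * ((h.feq_pair.Λ₀ s - 1 / (1 - s) * r 0) *
    (Complex.Gamma s)⁻¹ - r 0 * (Complex.Gamma (s + 1))⁻¹), ?_, fun s hs => ?_, ?_, ?_⟩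
  · intro s hs
    have hs1 : 1 - s ≠ 0 := sub_ne_zero.2 (Ne.symm hs)
    refine DifferentiableAt.differentiableWithinAt ?_
    have := hG s
    have := hG1 s
    have := hL s
    have := hP s
    have : DifferentiableAt ℂ (fun s : ℂ => 1 / (1 - s) * (r 0 : ℂ)) s := by
      fun_prop (disch := assumption)
    fun_prop
  · have hs0 : s ≠ 0 := by rintro rfl; norm_num at hs
    have hΛ := h.completed_eq hs
    have hΓ : Complex.Gamma s ≠ 0 := Complex.Gamma_ne_zero_of_re_pos (by linarith)
    have hpow : ((√a : ℝ) : ℂ) ^ s ≠ 0 := by simp [Complex.cpow_eq_zero_iff, ha']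
    beta_reduce
    rw [WeakFEPair.Λ₀_eq, hΛ, Complex.Gamma_add_one s hs0, Complex.cpow_neg]
    simp only [feq_pair, smul_eq_mul, Complex.ofReal_one]
    field_simp
    ring
  · have hlim : Tendsto (fun s : ℂ => ((√a : ℝ) : ℂ) ^ s * (((s - 1) * h.feq_pair.Λ₀ s + r 0) *
        (Complex.Gamma s)⁻¹ - (s - 1) * (r 0 * (Complex.Gamma (s + 1))⁻¹))) (𝓝[≠] 1)
        (𝓝 (((√a : ℝ) : ℂ) ^ (1 : ℂ) * ((((1 : ℂ) - 1) * h.feq_pair.Λ₀ 1 + r 0) *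
        (Complex.Gamma 1)⁻¹ - ((1 : ℂ) - 1) * (r 0 * (Complex.Gamma (1 + 1))⁻¹)))) := by
      refine Tendsto.mono_left (Continuous.tendsto ?_ 1) nhdsWithin_le_nhds
      have := hG.continuous
      have := hG1.continuous
      have := hL.continuous
      have := hP.continuous
      fun_prop
    have hv : ((√a : ℝ) : ℂ) ^ (1 : ℂ) * ((((1 : ℂ) - 1) * h.feq_pair.Λ₀ 1 + r 0) *
        (Complex.Gamma 1)⁻¹ - ((1 : ℂ) - 1) * (r 0 * (Complex.Gamma (1 + 1))⁻¹)) =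
        ((√a * r 0 : ℝ) : ℂ) := by
      simp
    rw [hv] at hlim
    refine hlim.congr' ?_
    filter_upwards [self_mem_nhdsWithin] with s hs
    have hs1 : s - 1 ≠ 0 := sub_ne_zero.2 hs
    have : (s - 1) * (1 / (1 - s)) = -1 := by
      rw [← neg_sub s 1]; field_simp
    linear_combination (((√a : ℝ) : ℂ) ^ s * r 0 * (Complex.Gamma s)⁻¹) * this
  · simp

end SelfDualTheta

/-! ### Theta functions of binary quadratic forms -/

theorem summable_int_exp_neg_mul_sq {c : ℝ} (hc : 0 < c) :
    Summable fun n : ℤ => Real.exp (-(c * (n : ℝ) ^ 2)) := by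
  have h := (summable_jacobiTheta₂_term_iff 0 (Complex.I * (c / Real.pi : ℝ))).2 (by
    simp; positivity)
  refine h.norm.congr fun n => ?_
  rw [norm_jacobiTheta₂_term]
  congr 1
  have := Real.pi_pos.ne'
  simp
  field_simp

theorem summable_int_prod_exp_neg {c d : ℝ} (hc : 0 < c) (hd : 0 < d) :
    Summable fun p : ℤ × ℤ => Real.exp (-(c * (p.1 : ℝ) ^ 2)) * Real.exp (-(d * (p.2 : ℝ) ^ 2)) :=
  (summable_int_exp_neg_mul_sq hc).mul_of_nonneg (summable_int_exp_neg_mul_sq hd)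
    (fun _ => (Real.exp_pos _).le) (fun _ => (Real.exp_pos _).le)

/-- The binary quadratic form `A m² + B m n + C n²`, evaluated at the pair `p = (n, m)`. -/
def binForm (A B C : ℝ) (p : ℤ × ℤ) : ℝ :=
  A * (p.2 : ℝ) ^ 2 + B * p.2 * p.1 + C * (p.1 : ℝ) ^ 2

theorem summable_exp_neg_binForm {A B C : ℝ} (hA : 0 < A) (hD : 0 < 4 * A * C - B ^ 2) {s : ℝ}
    (hs : 0 < s) : Summable fun p : ℤ × ℤ => Real.exp (-(s * binForm A B C p)) := by
  have hC : 0 < C := by nlinarith [sq_nonneg B]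
  set D := 4 * A * C - B ^ 2 with hDdef
  refine Summable.of_nonneg_of_le (fun _ => (Real.exp_pos _).le) (fun p => ?_)
    (summable_int_prod_exp_neg (c := s * (D / (8 * A))) (d := s * (D / (8 * C)))
      (by positivity) (by positivity))
  rw [← Real.exp_add]
  apply Real.exp_le_exp.2
  -- Completing the square in either variable bounds the form below by a multiple of the other
  -- variable's square; the average of the two bounds is used.
  have h1 : D / (4 * A) * (p.1 : ℝ) ^ 2 ≤ binForm A B C p := by
    rw [binForm, div_mul_eq_mul_div, div_le_iff₀ (by positivity), hDdef]
    nlinarith [sq_nonneg (2 * A * (p.2 : ℝ) + B * p.1)]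
  have h2 : D / (4 * C) * (p.2 : ℝ) ^ 2 ≤ binForm A B C p := by
    rw [binForm, div_mul_eq_mul_div, div_le_iff₀ (by positivity), hDdef]
    nlinarith [sq_nonneg (2 * C * (p.1 : ℝ) + B * p.2)]
  have e1 : D / (8 * A) = D / (4 * A) / 2 := by field_simp; norm_num
  have e2 : D / (8 * C) = D / (4 * C) / 2 := by field_simp; norm_num
  rw [e1, e2]
  nlinarith

theorem ofReal_cpow_one_half {a : ℝ} (ha : 0 ≤ a) : (a : ℂ) ^ (1 / 2 : ℂ) = (√a : ℝ) := by
  rw [Real.sqrt_eq_rpow, Complex.ofReal_cpow ha]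
  norm_num

open Complex in
/-- The theta function of a positive definite binary quadratic form is self-dual. -/
theorem tsum_exp_neg_binForm {A B C : ℝ} (hA : 0 < A) (hD : 0 < 4 * A * C - B ^ 2) {s : ℝ}
    (hs : 0 < s) :
    ∑' p : ℤ × ℤ, Real.exp (-(s * binForm A B C p)) =
      2 * Real.pi / (√(4 * A * C - B ^ 2) * s) *
        ∑' p : ℤ × ℤ, Real.exp (-(4 * Real.pi ^ 2 / ((4 * A * C - B ^ 2) * s) *
          binForm A B C p)) := by
  have hpi := Real.pi_pos
  set D := 4 * A * C - B ^ 2 with hDdef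
  have hA' : (A : ℂ) ≠ 0 := ofReal_ne_zero.2 hA.ne'
  have hD' : (D : ℂ) ≠ 0 := ofReal_ne_zero.2 hD.ne'
  have hs' : (s : ℂ) ≠ 0 := ofReal_ne_zero.2 hs.ne'
  have hpi' : (Real.pi : ℂ) ≠ 0 := ofReal_ne_zero.2 hpi.ne'
  have hDc : (D : ℂ) = 4 * A * C - B ^ 2 := by rw [hDdef]; push_cast; ring
  set s' := 4 * Real.pi ^ 2 / (D * s) with hs'def
  have hs'0 : 0 < s' := by positivity
  set a₁ : ℝ := s * A / Real.pi with ha₁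
  set a₂ : ℝ := s * D / (4 * Real.pi * A) with ha₂
  have ha₁0 : 0 < a₁ := by positivity
  have ha₂0 : 0 < a₂ := by positivity
  -- The terms after Poisson summation in m alone. They are absolutely summable over both indices,
  -- so the order can be exchanged before Poisson summation in n; this returns the same form at (-k,
  -- m), with s replaced by s'.
  set G : ℤ → ℤ → ℂ := fun n k => cexp (-(Real.pi ^ 2 / (s * A)) * k ^ 2 +
    I * Real.pi * (B / A) * k * n - s * (D / (4 * A)) * n ^ 2) with hG
  have hGs : Summable (Function.uncurry G) := by
    refine Summable.of_norm ?_
    refine (summable_int_prod_exp_neg (c := s * (D / (4 * A))) (d := Real.pi ^ 2 / (s * A))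
      (by positivity) (by positivity)).congr fun p => ?_
    simp only [Function.uncurry, hG]
    rw [norm_exp, ← Real.exp_add]
    congr 1
    have : (-(Real.pi ^ 2 / (s * A)) * (p.2 : ℂ) ^ 2 + I * Real.pi * (B / A) * p.2 * p.1 -
        s * (D / (4 * A)) * (p.1 : ℂ) ^ 2) = ((-(s * (D / (4 * A)) * (p.1 : ℝ) ^ 2) +
        -(Real.pi ^ 2 / (s * A) * (p.2 : ℝ) ^ 2) : ℝ) : ℂ) +
        ((Real.pi * (B / A) * p.2 * p.1 : ℝ) : ℂ) * I := by
      push_cast; ring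
    rw [this]
    simp only [add_re, ofReal_re, re_ofReal_mul, I_re, mul_zero, add_zero]
  have hF := summable_exp_neg_binForm hA hD hs
  have hF' := summable_exp_neg_binForm hA hD hs'0
  have h1 (n : ℤ) : ∑' m : ℤ, ((Real.exp (-(s * binForm A B C (n, m))) : ℝ) : ℂ) =
      1 / (√a₁ : ℝ) * ∑' k : ℤ, G n k := by
    have h := tsum_exp_neg_quadratic (a := (a₁ : ℂ)) (by simpa using ha₁0)
      (-(s * B * n / (2 * Real.pi)))
    rw [ofReal_cpow_one_half ha₁0.le] at h
    have e1 (m : ℤ) : ((Real.exp (-(s * binForm A B C (n, m))) : ℝ) : ℂ) =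
        cexp (-(s * C * n ^ 2)) * cexp (-Real.pi * a₁ * m ^ 2 +
          2 * Real.pi * (-(s * B * n / (2 * Real.pi))) * m) := by
      rw [← Complex.exp_add, ofReal_exp]
      congr 1
      simp only [binForm, ha₁]
      push_cast
      field_simp
      ring
    have e2 (k : ℤ) : G n k = cexp (-(s * C * n ^ 2)) *
        cexp (-Real.pi / a₁ * (k + I * (-(s * B * n / (2 * Real.pi)))) ^ 2) := by
      rw [← Complex.exp_add]
      simp only [hG]
      congr 1
      rw [ha₁, hDc]
      push_cast
      field_simp
      ring_nf
      rw [I_sq]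
      ring
    simp_rw [e1, e2, tsum_mul_left, h]
    ring
  have h2 (k : ℤ) : ∑' n : ℤ, G n k = 1 / (√a₂ : ℝ) *
      ∑' m : ℤ, ((Real.exp (-(s' * binForm A B C (-k, m))) : ℝ) : ℂ) := by
    have h := tsum_exp_neg_quadratic (a := (a₂ : ℂ)) (by simpa using ha₂0)
      (I * B * k / (2 * A))
    rw [ofReal_cpow_one_half ha₂0.le] at h
    have e1 (n : ℤ) : G n k = cexp (-(Real.pi ^ 2 / (s * A)) * k ^ 2) *
        cexp (-Real.pi * a₂ * n ^ 2 + 2 * Real.pi * (I * B * k / (2 * A)) * n) := by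
      rw [← Complex.exp_add]
      simp only [hG]
      congr 1
      rw [ha₂]
      push_cast
      field_simp
      ring
    have e2 (m : ℤ) : ((Real.exp (-(s' * binForm A B C (-k, m))) : ℝ) : ℂ) =
        cexp (-(Real.pi ^ 2 / (s * A)) * k ^ 2) *
        cexp (-Real.pi / a₂ * (m + I * (I * B * k / (2 * A))) ^ 2) := by
      rw [← Complex.exp_add, ofReal_exp]
      congr 1
      have hI : I * (I * B * k / (2 * A)) = -(B * k / (2 * A)) := by
        rw [← mul_div_assoc, ← mul_assoc, ← mul_assoc, I_mul_I]; ring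
      rw [hI]
      simp only [binForm, ha₂, hs'def]
      push_cast
      field_simp
      rw [hDc]
      ring
    simp_rw [e1, e2, tsum_mul_left, h]
    ring
  have hpre : 1 / ((√a₁ : ℝ) : ℂ) * (1 / (√a₂ : ℝ)) =
      ((2 * Real.pi / (√D * s) : ℝ) : ℂ) := by
    rw [← ofReal_one, ← ofReal_div, ← ofReal_div, ← ofReal_mul]
    congr 1
    rw [one_div_mul_one_div, ← Real.sqrt_mul ha₁0.le]
    have : a₁ * a₂ = D * (s / (2 * Real.pi)) ^ 2 := by
      rw [ha₁, ha₂]; field_simp; norm_num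
    rw [this, Real.sqrt_mul hD.le, Real.sqrt_sq (by positivity)]
    have := Real.sqrt_pos.2 hD
    field_simp
  have hFc := Complex.summable_ofReal.2 hF
  have hFc' := Complex.summable_ofReal.2 (((Equiv.neg ℤ).prodCongr (Equiv.refl ℤ)).summable_iff.2 hF')
  rw [← ofReal_inj, ofReal_mul, ofReal_tsum, ofReal_tsum, hFc.tsum_prod]
  simp_rw [h1]
  rw [tsum_mul_left, ← hGs.tsum_comm]
  simp_rw [h2]
  rw [tsum_mul_left, ← mul_assoc, hpre,
    ← ((Equiv.neg ℤ).prodCongr (Equiv.refl ℤ)).tsum_eq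
      (fun p => ((Real.exp (-(s' * binForm A B C p)) : ℝ) : ℂ))]
  congr 1
  exact (hFc'.tsum_prod).symm

/-! ### Norm forms of ideals in an imaginary quadratic field -/

section ImaginaryQuadratic

variable {K : Type*} [Field K] [NumberField K]

/-- The two embeddings of an imaginary quadratic field into `ℂ`. -/
def quadraticEmbeddings (φ : K →+* ℂ) : Fin 2 → (K →ₐ[ℚ] ℂ) :=
  ![φ.toRatAlgHom, (ComplexEmbedding.conjugate φ).toRatAlgHom]

theorem quadraticEmbeddings_bijective (hdeg : Module.finrank ℚ K = 2) (himag : IsTotallyComplex K)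
    (φ : K →+* ℂ) : Function.Bijective (quadraticEmbeddings φ) := by
  have hne : ComplexEmbedding.conjugate φ ≠ φ := fun h =>
    InfinitePlace.isComplex_mk_iff.1 (himag.isComplex (InfinitePlace.mk φ))
      (ComplexEmbedding.isReal_iff.2 h)
  rw [Fintype.bijective_iff_injective_and_card]
  constructor
  · have h01 : quadraticEmbeddings φ 0 ≠ quadraticEmbeddings φ 1 := by
      intro h
      apply hne
      ext x
      exact (DFunLike.congr_fun h x).symm
    intro i j hij
    fin_cases i <;> fin_cases j
    · rfl
    · exact absurd hij h01
    · exact absurd hij.symm h01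
    · rfl
  · rw [AlgHom.card, hdeg, Fintype.card_fin]

theorem normSq_embedding_eq_absNorm (hdeg : Module.finrank ℚ K = 2) (himag : IsTotallyComplex K)
    (φ : K →+* ℂ) (x : 𝓞 K) :
    Complex.normSq (φ x) = (Ideal.absNorm (Ideal.span {x}) : ℝ) := by
  have h := Algebra.norm_eq_prod_embeddings ℚ ℂ (x : K)
  rw [← (Equiv.ofBijective _ (quadraticEmbeddings_bijective hdeg himag φ)).prod_comp,
    Fin.prod_univ_two] at h
  have h' : ((Algebra.norm ℤ x : ℤ) : ℂ) = (Complex.normSq (φ x) : ℂ) := by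
    rw [Complex.normSq_eq_conj_mul_self, mul_comm]
    have := Algebra.coe_norm_int x
    rw [← this] at h
    simpa [quadraticEmbeddings] using h
  have h'' : ((Algebra.norm ℤ x : ℤ) : ℝ) = Complex.normSq (φ x) := by exact_mod_cast h'
  rw [Ideal.absNorm_span_singleton, Nat.cast_natAbs, Int.cast_abs, h'',
    abs_of_nonneg (Complex.normSq_nonneg _)]

/-- The signed area spanned by two complex numbers. -/
def cross (z w : ℂ) : ℝ := z.re * w.im - z.im * w.re

/-- The matrix with rows (z, w) and (z̄, w̄) has determinant -2i times the signed area, and the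
discriminant is its square. -/
theorem abs_discr_eq_cross (hdeg : Module.finrank ℚ K = 2) (himag : IsTotallyComplex K)
    (φ : K →+* ℂ) (b : Module.Basis (Fin 2) ℤ (𝓞 K)) :
    |(discr K : ℝ)| = 4 * cross (φ (b 0)) (φ (b 1)) ^ 2 := by
  have h1 : (discr K : ℚ) = Algebra.discr ℚ (fun i => (b i : K)) := by
    rw [← discr_eq_discr K b]
    have := Algebra.discr_localizationLocalization ℤ (nonZeroDivisors ℤ) K b (Rₘ := ℚ)
    rw [eq_intCast] at this
    rw [← this]
    congr 1
    ext i
    simp [Module.Basis.localizationLocalization_apply]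
  have h2 := Algebra.discr_eq_det_embeddingsMatrixReindex_pow_two ℚ ℂ (fun i => (b i : K))
    (Equiv.ofBijective _ (quadraticEmbeddings_bijective hdeg himag φ))
  rw [← h1, Matrix.det_fin_two] at h2
  have h3 : ((discr K : ℝ) : ℂ) = ((-(4 * cross (φ (b 0)) (φ (b 1)) ^ 2) : ℝ) : ℂ) := by
    have : ((discr K : ℝ) : ℂ) = algebraMap ℚ ℂ (discr K : ℚ) := by simp
    rw [this, h2]
    simp only [Algebra.embeddingsMatrixReindex, Algebra.embeddingsMatrix, Matrix.reindex_apply,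
      Matrix.submatrix_apply, Matrix.of_apply, quadraticEmbeddings, Equiv.ofBijective_apply,
      Equiv.refl_symm, Equiv.coe_refl, id, Equiv.symm_symm, Matrix.cons_val_zero, Matrix.cons_val_one,
      RingHom.toRatAlgHom_apply, ComplexEmbedding.conjugate_coe_eq]
    generalize φ (b 0) = z
    generalize φ (b 1) = w
    apply Complex.ext
    · simp [cross, pow_two]; ring
    · simp [cross, pow_two]
  rw [Complex.ofReal_inj.1 h3, abs_neg, abs_of_nonneg (by positivity)]

/-- The norm form of a nonzero ideal, of discriminant `-|d_K|`. -/
theorem exists_binForm_of_ideal (hdeg : Module.finrank ℚ K = 2) (himag : IsTotallyComplex K)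
    {J : Ideal (𝓞 K)} (hJ : J ≠ ⊥) :
    ∃ (A B C : ℝ) (e : ℤ × ℤ ≃ J), 0 < A ∧ 4 * A * C - B ^ 2 = |(discr K : ℝ)| ∧
      ∀ p, binForm A B C p =
        (Ideal.absNorm (Ideal.span {(e p : 𝓞 K)}) : ℝ) / (Ideal.absNorm J : ℝ) := by
  obtain ⟨φ⟩ : Nonempty (K →+* ℂ) := inferInstance
  have hrank : Module.finrank ℤ (𝓞 K) = 2 := by rw [RingOfIntegers.rank, hdeg]
  set b := Module.finBasisOfFinrankEq ℤ (𝓞 K) hrank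
  set c := Ideal.selfBasis b J hJ with hc
  set N : ℝ := (Ideal.absNorm J : ℝ) with hN
  have hN0 : 0 < N := by
    have : Ideal.absNorm J ≠ 0 := mt Ideal.absNorm_eq_zero_iff.1 hJ
    positivity
  set z := φ (c 0 : 𝓞 K) with hz
  set w := φ (c 1 : 𝓞 K) with hw
  -- The change of basis from 𝓞 K to J has determinant ±N(J). After division by N(J) the
  -- discriminant therefore does not depend on J, and all classes share the same a.
  have hcross : 4 * cross z w ^ 2 = N ^ 2 * |(discr K : ℝ)| := by
    have hdet := Ideal.natAbs_det_basis_change b J c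
    rw [Module.Basis.det_apply, Matrix.det_fin_two] at hdet
    simp only [Module.Basis.toMatrix_apply, Function.comp_apply] at hdet
    have hexp (i : Fin 2) : φ (c i : 𝓞 K) = (b.repr (c i) 0 : ℤ) * φ (b 0) +
        (b.repr (c i) 1 : ℤ) * φ (b 1) := by
      conv_lhs => rw [← b.sum_repr (c i : 𝓞 K), Fin.sum_univ_two]
      simp
    rw [abs_discr_eq_cross hdeg himag φ b, hN, ← hdet, hz, hw, hexp 0, hexp 1, Nat.cast_natAbs,
      Int.cast_abs, sq_abs]
    generalize φ (b 0) = u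
    generalize φ (b 1) = v
    simp [cross]
    ring
  have hz0 : z ≠ 0 := by
    rw [hz, Ne, map_eq_zero_iff φ φ.injective]
    have := c.ne_zero 0
    simpa using this
  refine ⟨Complex.normSq z / N, 2 * (z.re * w.re + z.im * w.im) / N, Complex.normSq w / N,
    ((Equiv.prodComm ℤ ℤ).trans (finTwoArrowEquiv ℤ).symm).trans c.equivFun.symm.toEquiv,
    div_pos (Complex.normSq_pos.2 hz0) hN0, ?_, fun p => ?_⟩
  · have : 4 * (Complex.normSq z / N) * (Complex.normSq w / N) -
        (2 * (z.re * w.re + z.im * w.im) / N) ^ 2 = 4 * cross z w ^ 2 / N ^ 2 := by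
      simp only [Complex.normSq_apply, cross]; field_simp; ring
    rw [this, hcross]
    field_simp
  · rw [← normSq_embedding_eq_absNorm hdeg himag φ]
    have he : φ ((((Equiv.prodComm ℤ ℤ).trans (finTwoArrowEquiv ℤ).symm).trans
        c.equivFun.symm.toEquiv) p : 𝓞 K) = (p.2 : ℂ) * z + (p.1 : ℂ) * w := by
      simp [Module.Basis.equivFun_symm_apply, Fin.sum_univ_two, hz, hw]
    rw [he]
    simp only [binForm, Complex.normSq_apply]
    simp
    field_simp
    ring

/-- There is a single infinite place, hence unit rank 0, and every unit is a root of unity. -/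
theorem finite_units_of_imaginary (hdeg : Module.finrank ℚ K = 2) (himag : IsTotallyComplex K) :
    Finite (𝓞 K)ˣ := by
  have h0 := IsTotallyComplex.nrRealPlaces_eq_zero K
  have h1 := IsTotallyComplex.finrank K
  have hr : Units.rank K = 0 := by
    rw [Units.rank, InfinitePlace.card_eq_nrRealPlaces_add_nrComplexPlaces]
    omega
  have : IsEmpty (Fin (Units.rank K)) := by rw [hr]; infer_instance
  have htop : Units.torsion K = ⊤ := by
    refine (Subgroup.eq_top_iff' _).2 fun u => ?_
    obtain ⟨⟨ζ, f⟩, h, -⟩ := Units.exist_unique_eq_mul_prod K u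
    rw [Fintype.prod_empty, mul_one] at h
    rw [h]
    exact ζ.2
  have hf : Finite (Units.torsion K) := inferInstance
  rw [htop] at hf
  exact Finite.of_equiv _ Subgroup.topEquiv.toEquiv

end ImaginaryQuadratic

/-! ### Theta series of ideal classes -/

section IdealTheta

open scoped nonZeroDivisors

variable {K : Type*} [Field K] [NumberField K]

/-- Nonzero elements of an ideal `J` correspond to pairs of an ideal in the class inverse to that
of `J` and a unit. -/
theorem exists_equiv_class_prod_units {J : (Ideal (𝓞 K))⁰} {c : ClassGroup (𝓞 K)}
    (hJ : ClassGroup.mk0 J = c⁻¹) :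
    ∃ E : {I : (Ideal (𝓞 K))⁰ // ClassGroup.mk0 I = c} × (𝓞 K)ˣ ≃
        {x : (J : Ideal (𝓞 K)) // x ∉ ({0} : Finset (J : Ideal (𝓞 K)))},
      ∀ p, Ideal.span {((E p : (J : Ideal (𝓞 K))) : 𝓞 K)} =
        ((p.1 : (Ideal (𝓞 K))⁰) : Ideal (𝓞 K)) * (J : Ideal (𝓞 K)) := by
  have hJ0 : (J : Ideal (𝓞 K)) ≠ 0 := nonZeroDivisors.coe_ne_zero J
  have hgen (I : {I : (Ideal (𝓞 K))⁰ // ClassGroup.mk0 I = c}) : ∃ g : 𝓞 K,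
      Ideal.span {g} = ((I : (Ideal (𝓞 K))⁰) : Ideal (𝓞 K)) * (J : Ideal (𝓞 K)) := by
    have h1 : ClassGroup.mk0 ((I : (Ideal (𝓞 K))⁰) * J) = 1 := by
      rw [map_mul, I.2, hJ, mul_inv_cancel]
    have h2 := (ClassGroup.mk0_eq_one_iff ((I : (Ideal (𝓞 K))⁰) * J).2).1 h1
    obtain ⟨g, hg⟩ := h2.principal
    exact ⟨g, hg.symm⟩
  choose g hg using hgen
  have hg0 (I : {I : (Ideal (𝓞 K))⁰ // ClassGroup.mk0 I = c}) : g I ≠ 0 := by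
    intro h0
    have h1 := hg I
    rw [h0, Ideal.span_singleton_zero] at h1
    exact (mul_ne_zero (nonZeroDivisors.coe_ne_zero I.1) hJ0) h1.symm
  have hspan (p : {I : (Ideal (𝓞 K))⁰ // ClassGroup.mk0 I = c} × (𝓞 K)ˣ) :
      Ideal.span {g p.1 * (p.2 : 𝓞 K)} =
        ((p.1 : (Ideal (𝓞 K))⁰) : Ideal (𝓞 K)) * (J : Ideal (𝓞 K)) := by
    rw [← hg p.1, Ideal.span_singleton_eq_span_singleton]
    exact (associated_mul_unit_left _ _ p.2.isUnit)
  have hmem (p : {I : (Ideal (𝓞 K))⁰ // ClassGroup.mk0 I = c} × (𝓞 K)ˣ) :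
      g p.1 * (p.2 : 𝓞 K) ∈ (J : Ideal (𝓞 K)) := by
    refine (Ideal.span_singleton_le_iff_mem (J : Ideal (𝓞 K))).1 ((hspan p).trans_le ?_)
    exact Ideal.mul_le_right
  -- With g I a fixed generator of the principal ideal I J, the pair (I, u) goes to g I · u; an
  -- element x of J comes from I = (x) J⁻¹.
  refine ⟨Equiv.ofBijective (fun p => ⟨⟨g p.1 * (p.2 : 𝓞 K), hmem p⟩, ?_⟩) ⟨?_, ?_⟩, hspan⟩
  · rw [Finset.mem_singleton, ← Subtype.coe_inj]
    exact mul_ne_zero (hg0 _) p.2.ne_zero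
  · rintro ⟨I, u⟩ ⟨I', u'⟩ h
    have h1 : g I * (u : 𝓞 K) = g I' * (u' : 𝓞 K) := by
      simpa using h
    have h2 : I = I' := by
      have := hspan (I, u)
      simp only at this
      rw [h1, hspan (I', u')] at this
      exact Subtype.ext (Subtype.ext (mul_right_cancel₀ hJ0 this.symm))
    subst h2
    rw [Prod.mk.injEq]
    exact ⟨rfl, Units.ext (mul_left_cancel₀ (hg0 I) h1)⟩
  · rintro ⟨⟨x, hxJ⟩, hx⟩
    have hx0 : x ≠ 0 := by
      rintro rfl
      exact hx (by simp)
    obtain ⟨I, hI⟩ := Ideal.dvd_iff_le.2 ((Ideal.span_singleton_le_iff_mem _).2 hxJ)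
    have hI0 : I ≠ 0 := by
      rintro rfl
      rw [mul_zero] at hI
      exact hx0 (Ideal.span_singleton_eq_bot.1 hI)
    set I' : (Ideal (𝓞 K))⁰ := ⟨I, mem_nonZeroDivisors_of_ne_zero hI0⟩ with hI'
    have hprin : ClassGroup.mk0 (I' * J) = 1 := by
      refine (ClassGroup.mk0_eq_one_iff (I' * J).2).2 ⟨⟨x, ?_⟩⟩
      change I * (J : Ideal (𝓞 K)) = Ideal.span {x}
      rw [hI, mul_comm]
    have hcl : ClassGroup.mk0 I' = c := by
      rw [map_mul, hJ, mul_inv_eq_one] at hprin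
      exact hprin
    have hass : Associated (g ⟨I', hcl⟩) x := by
      rw [← Ideal.span_singleton_eq_span_singleton, hg, hI, mul_comm]
    obtain ⟨u, hu⟩ := hass
    exact ⟨(⟨I', hcl⟩, u), Subtype.ext (Subtype.ext hu)⟩

/-- The theta series of an ideal class. -/
theorem hasSum_class_exp_neg [Finite (𝓞 K)ˣ] {J : (Ideal (𝓞 K))⁰} {c : ClassGroup (𝓞 K)}
    (hJ : ClassGroup.mk0 J = c⁻¹) {A B C : ℝ} {e : ℤ × ℤ ≃ (J : Ideal (𝓞 K))}
    (he : ∀ p, binForm A B C p = (Ideal.absNorm (Ideal.span {(e p : 𝓞 K)}) : ℝ) /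
      (Ideal.absNorm (J : Ideal (𝓞 K)) : ℝ))
    {s : ℝ} (hs : Summable fun p : ℤ × ℤ => Real.exp (-(s * binForm A B C p))) :
    HasSum (fun I : {I : (Ideal (𝓞 K))⁰ // ClassGroup.mk0 I = c} =>
      Real.exp (-(s * (Ideal.absNorm ((I : (Ideal (𝓞 K))⁰) : Ideal (𝓞 K)) : ℝ))))
      ((∑' p : ℤ × ℤ, Real.exp (-(s * binForm A B C p)) - 1) / (Nat.card (𝓞 K)ˣ : ℝ)) := by
  have hJ0 : (Ideal.absNorm (J : Ideal (𝓞 K)) : ℝ) ≠ 0 := by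
    have := mt Ideal.absNorm_eq_zero_iff.1 (nonZeroDivisors.coe_ne_zero J)
    exact_mod_cast this
  set f : ↥(J : Ideal (𝓞 K)) → ℝ := fun x => Real.exp (-(s *
    ((Ideal.absNorm (Ideal.span {(x : 𝓞 K)}) : ℝ) / (Ideal.absNorm (J : Ideal (𝓞 K)) : ℝ))))
    with hf
  have h1 : HasSum f (∑' p : ℤ × ℤ, Real.exp (-(s * binForm A B C p))) := by
    rw [← e.hasSum_iff]
    refine (congrArg (HasSum · _) ?_).mpr hs.hasSum
    ext p
    simp only [hf, Function.comp_apply]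
    rw [he]
  -- Removing the zero element removes the value 1; afterwards every ideal is hit once per unit,
  -- hence the division by their number.
  have h2 : HasSum (fun x : {x // x ∉ ({0} : Finset (J : Ideal (𝓞 K)))} => f x)
      (∑' p : ℤ × ℤ, Real.exp (-(s * binForm A B C p)) - 1) := by
    rw [Finset.hasSum_compl_iff]
    refine (congrArg (HasSum f) ?_).mpr h1
    rw [Finset.sum_singleton]
    simp [hf]
  obtain ⟨E, hE⟩ := exists_equiv_class_prod_units hJ
  rw [← E.hasSum_iff] at h2
  have h3 (p : {I : (Ideal (𝓞 K))⁰ // ClassGroup.mk0 I = c} × (𝓞 K)ˣ) : f (E p) =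
      Real.exp (-(s * (Ideal.absNorm ((p.1 : (Ideal (𝓞 K))⁰) : Ideal (𝓞 K)) : ℝ))) := by
    simp only [hf]
    rw [hE, map_mul, Nat.cast_mul, mul_div_cancel_right₀ _ hJ0]
  have h4 : HasSum (fun p : {I : (Ideal (𝓞 K))⁰ // ClassGroup.mk0 I = c} × (𝓞 K)ˣ =>
      Real.exp (-(s * (Ideal.absNorm ((p.1 : (Ideal (𝓞 K))⁰) : Ideal (𝓞 K)) : ℝ))))
      (∑' p : ℤ × ℤ, Real.exp (-(s * binForm A B C p)) - 1) :=
    (congrArg (HasSum · _) (funext h3)).mp h2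
  have := Fintype.ofFinite (𝓞 K)ˣ
  have h5 := h4.prod_fiberwise fun I => hasSum_fintype _
  simp only [Finset.sum_const, Finset.card_univ, nsmul_eq_mul] at h5
  have hw : (Fintype.card (𝓞 K)ˣ : ℝ) ≠ 0 := by exact_mod_cast Fintype.card_ne_zero
  rw [Nat.card_eq_fintype_card]
  refine (congrArg (HasSum · _) ?_).mp (h5.div_const (Fintype.card (𝓞 K)ˣ : ℝ))
  ext I
  field_simp

theorem hasSum_idealNormCount_exp_neg {s S : ℝ} (h : HasSum (fun I : (Ideal (𝓞 K))⁰ =>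
    Real.exp (-(s * (Ideal.absNorm (I : Ideal (𝓞 K)) : ℝ)))) S) :
    HasSum (fun n : ℕ => (idealNormCount K n : ℝ) * Real.exp (-(n * s))) S := by
  set N : (Ideal (𝓞 K))⁰ → ℕ := fun I => Ideal.absNorm (I : Ideal (𝓞 K)) with hN
  rw [← (Equiv.sigmaFiberEquiv N).hasSum_iff] at h
  refine h.sigma fun n => ?_
  have eq : {I : (Ideal (𝓞 K))⁰ // N I = n} ≃
      {I : Ideal (𝓞 K) // I ≠ ⊥ ∧ Ideal.absNorm I = n} :=
    { toFun := fun I => ⟨I.1, nonZeroDivisors.coe_ne_zero I.1, I.2⟩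
      invFun := fun I => ⟨⟨I.1, mem_nonZeroDivisors_of_ne_zero I.2.1⟩, I.2.2⟩
      left_inv := fun I => rfl
      right_inv := fun I => rfl }
  have hfin : Finite {I : Ideal (𝓞 K) // I ≠ ⊥ ∧ Ideal.absNorm I = n} := by
    rcases Nat.eq_zero_or_pos n with rfl | hn
    · have : IsEmpty {I : Ideal (𝓞 K) // I ≠ ⊥ ∧ Ideal.absNorm I = 0} :=
        ⟨fun I => I.2.1 (Ideal.absNorm_eq_zero_iff.1 I.2.2)⟩
      infer_instance
    · exact ((Ideal.finite_setOfPred_absNorm_eq n).subset fun I hI => hI.2).to_subtype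
  have hfin' : Finite {I : (Ideal (𝓞 K))⁰ // N I = n} := Finite.of_equiv _ eq.symm
  have := Fintype.ofFinite {I : (Ideal (𝓞 K))⁰ // N I = n}
  have h1 := hasSum_fintype (fun _ : {I : (Ideal (𝓞 K))⁰ // N I = n} => Real.exp (-(n * s)))
  rw [Finset.sum_const, Finset.card_univ, ← Nat.card_eq_fintype_card, Nat.card_congr eq,
    nsmul_eq_mul] at h1
  refine (congrArg (HasSum · _) ?_).mp h1
  ext I
  have := I.2
  simp only [hN] at this
  simp [Equiv.sigmaFiberEquiv, this, mul_comm s]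

/-- The number of ideals of norm `n`, with the value `h / w` at `n = 0`. -/
def idealThetaCoeff (K : Type*) [Field K] [NumberField K] (n : ℕ) : ℝ :=
  idealNormCount K n + if n = 0 then (classNumber K : ℝ) / Nat.card (𝓞 K)ˣ else 0

theorem selfDualTheta_idealThetaCoeff (hdeg : Module.finrank ℚ K = 2)
    (himag : IsTotallyComplex K) :
    SelfDualTheta (idealThetaCoeff K) (4 * Real.pi ^ 2 / |(discr K : ℝ)|) := by
  have hfin := finite_units_of_imaginary hdeg himag
  have hD : 0 < |(discr K : ℝ)| := abs_pos.2 (Int.cast_ne_zero.2 (discr_ne_zero K))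
  set D := |(discr K : ℝ)| with hDdef
  set w : ℝ := (Nat.card (𝓞 K)ˣ : ℝ) with hw
  have hw0 : 0 ≤ w := Nat.cast_nonneg _
  have hsurj (c : ClassGroup (𝓞 K)) : ∃ J : (Ideal (𝓞 K))⁰, ClassGroup.mk0 J = c⁻¹ :=
    ClassGroup.mk0_surjective _
  choose J hJ using hsurj
  choose A B C e hA hABC he using fun c =>
    exists_binForm_of_ideal hdeg himag (nonZeroDivisors.coe_ne_zero (J c))
  have hABC0 (c : ClassGroup (𝓞 K)) : 0 < 4 * A c * C c - B c ^ 2 := by rw [hABC]; exact hD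
  set T : ClassGroup (𝓞 K) → ℝ → ℝ := fun c s =>
    ∑' p : ℤ × ℤ, Real.exp (-(s * binForm (A c) (B c) (C c) p)) with hT
  have hsum (s : ℝ) (hs : 0 < s) :
      HasSum (fun n : ℕ => idealThetaCoeff K n * Real.exp (-(n * s))) ((∑ c, T c s) / w) := by
    have h1 (c : ClassGroup (𝓞 K)) := hasSum_class_exp_neg (hJ c) (he c)
      (summable_exp_neg_binForm (hA c) (hABC0 c) hs)
    set g : (Ideal (𝓞 K))⁰ → ℝ := fun I =>
      Real.exp (-(s * (Ideal.absNorm (I : Ideal (𝓞 K)) : ℝ))) with hg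
    have h2 : HasSum g (∑ c, (T c s - 1) / w) := by
      rw [← (Equiv.sigmaFiberEquiv (fun I : (Ideal (𝓞 K))⁰ => ClassGroup.mk0 I)).hasSum_iff]
      refine HasSum.sigma_of_hasSum (hasSum_fintype _) (fun c => h1 c) ?_
      exact (summable_sigma_of_nonneg fun _ => (Real.exp_pos _).le).2 ⟨fun c => (h1 c).summable, Summable.of_finite⟩
    have h3 := hasSum_idealNormCount_exp_neg h2
    have h4 : HasSum (fun n : ℕ => if n = 0 then (classNumber K : ℝ) / w else 0)
        ((classNumber K : ℝ) / w) := hasSum_ite_eq 0 _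
    have h5 := h3.add h4
    -- The -1 lost in each class adds up to h/w, which the coefficient at n = 0 restores; the full
    -- sum then inherits the functional equation from each T c.
    have e1 : ∑ c, (T c s - 1) / w + (classNumber K : ℝ) / w = (∑ c, T c s) / w := by
      rw [← Finset.sum_div, Finset.sum_sub_distrib, ← add_div]
      congr 1
      simp [classNumber]
    rw [e1] at h5
    refine (congrArg (HasSum · _) ?_).mp h5
    ext n
    rw [idealThetaCoeff]
    split_ifs with hn
    · simp [hn, hw]
    · simp
  refine ⟨fun n => ?_, by positivity, fun s hs => (hsum s hs).summable, fun s hs => ?_⟩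
  · rw [idealThetaCoeff]
    split_ifs <;> positivity
  · rw [(hsum s hs).tsum_eq, (hsum _ (by positivity)).tsum_eq, ← mul_div_assoc, Finset.mul_sum]
    congr 1
    refine Finset.sum_congr rfl fun c _ => ?_
    simp only [hT]
    rw [tsum_exp_neg_binForm (hA c) (hABC0 c) hs, hABC]
    congr 1
    · rw [Real.sqrt_div (by positivity), show 4 * Real.pi ^ 2 = (2 * Real.pi) ^ 2 by ring,
        Real.sqrt_sq (by positivity), div_div]
    · simp_rw [← hDdef, div_div]

end IdealTheta

/-! ### Translation to the Bessel series and conclusion -/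

section Main

variable {K : Type*} [Field K] [NumberField K]

theorem idealThetaCoeff_of_ne_zero {n : ℕ} (hn : n ≠ 0) :
    idealThetaCoeff K n = idealNormCount K n := by
  simp [idealThetaCoeff, hn]

theorem natCard_absNorm_eq {n : ℕ} (hn : n ≠ 0) :
    Nat.card {I : Ideal (𝓞 K) // Ideal.absNorm I = n} = idealNormCount K n := by
  refine Nat.card_congr (Equiv.subtypeEquivRight fun I => ⟨fun h => ⟨?_, h⟩, fun h => h.2⟩)
  rintro rfl
  exact hn (h.symm.trans Ideal.absNorm_bot)

theorem LSeries_idealThetaCoeff (s : ℂ) :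
    LSeries (fun n => (idealThetaCoeff K n : ℂ)) s = dedekindZeta K s := by
  refine LSeries_congr (fun {n} hn => ?_) s
  rw [idealThetaCoeff_of_ne_zero hn, natCard_absNorm_eq hn, Complex.ofReal_natCast]

theorem idealCount_eq_sum (x : ℝ) : idealCount K x =
    ∑ n ∈ Finset.Icc 1 ⌊x⌋₊, (if (n : ℝ) = x then 1 / 2 else 1) * idealThetaCoeff K n := by
  refine Finset.sum_congr rfl fun n hn => ?_
  rw [idealThetaCoeff_of_ne_zero (by have := (Finset.mem_Icc.1 hn).1; omega)]

theorem besselJ_one_mul_sqrt {D t : ℝ} (hD : 0 < D) (ht : 0 ≤ t) :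
    besselJ 1 (4 * Real.pi * √t / √D) * √t =
      √(4 * Real.pi ^ 2 / D) * t * besselE 1 (4 * Real.pi ^ 2 / D * t) := by
  have hs : √(4 * Real.pi ^ 2 / D) = 2 * Real.pi / √D := by
    rw [Real.sqrt_div (by positivity), show 4 * Real.pi ^ 2 = (2 * Real.pi) ^ 2 by ring,
      Real.sqrt_sq (by positivity)]
  have h1 : 4 * Real.pi * √t / √D = 2 * √(4 * Real.pi ^ 2 / D * t) := by
    rw [Real.sqrt_mul (by positivity), hs]
    ring
  rw [h1, besselJ_one_two_mul_sqrt (by positivity), Real.sqrt_mul (by positivity)]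
  linear_combination √(4 * Real.pi ^ 2 / D) * besselE 1 (4 * Real.pi ^ 2 / D * t) *
    Real.mul_self_sqrt ht

end Main

end

theorem mainTheorem10 (K : Type*) [Field K] [NumberField K]
    (hdeg : Module.finrank ℚ K = 2) (himag : IsTotallyComplex K) :
    ∃ (Z : ℂ → ℂ) (H : ℝ),
      IsDedekindZetaContinuation K Z ∧
      Tendsto (fun s : ℂ => (s - 1) * Z s) (𝓝[≠] 1) (𝓝 (H : ℂ)) ∧
      ∀ x : ℝ, 0 < x →
        ∃ S : ℝ,
          Tendsto (fun N : ℕ => ∑ n ∈ Finset.Icc 1 N,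
            (idealNormCount K n : ℝ) / (n : ℝ) *
              besselJ 1 (4 * Real.pi * √((n : ℝ) * x) / √(|(discr K : ℝ)|)) *
              √((n : ℝ) * x)) atTop (𝓝 S) ∧
          (idealCount K x : ℂ) = Z 0 + (H : ℂ) * (x : ℂ) + (S : ℂ) := by
  have h := selfDualTheta_idealThetaCoeff hdeg himag
  have hD : 0 < |(discr K : ℝ)| := abs_pos.2 (Int.cast_ne_zero.2 (discr_ne_zero K))
  obtain ⟨Z, hZ, hL, hres, h0⟩ := h.exists_continuation
  refine ⟨Z, _, ⟨hZ, fun s hs => (hL s hs).trans (LSeries_idealThetaCoeff s)⟩, hres,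
    fun x hx => ?_⟩
  set D := |(discr K : ℝ)|
  set a := 4 * Real.pi ^ 2 / D with ha
  -- Hardy's limit minus its term n = 0, which is √a r(0) x = Hx because E_1(0) = 1. The remaining
  -- r(0) is -Z(0).
  refine ⟨idealThetaCoeff K 0 + idealCount K x - √a * idealThetaCoeff K 0 * x, ?_, ?_⟩
  · rw [idealCount_eq_sum]
    refine ((h.tendsto_sum_range_besselE hx).sub_const
      (√a * idealThetaCoeff K 0 * x)).congr fun N => ?_
    rw [Finset.sum_range_succ', sub_eq_iff_eq_add, Finset.range_eq_Ico,
      Finset.sum_Ico_add' (fun n : ℕ => idealThetaCoeff K n * (√a * x * besselE 1 (a * x * n))),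
      zero_add]
    congr 1
    · refine Finset.sum_congr rfl fun n hn => ?_
      have hn0 : n ≠ 0 := by have := (Finset.mem_Icc.1 hn).1; omega
      have hn' : (n : ℝ) ≠ 0 := Nat.cast_ne_zero.2 hn0
      rw [idealThetaCoeff_of_ne_zero hn0, mul_assoc (_ / _) (besselJ _ _),
        besselJ_one_mul_sqrt hD (mul_nonneg n.cast_nonneg hx.le), ← ha, mul_assoc a x, mul_comm x]
      field_simp
    · rw [Nat.cast_zero, mul_zero, besselE_zero_right]
      simp
      ring
  · rw [h0]
    push_cast
    ring
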